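/- Let $0<\beta<\gamma<1$, $0\le\mu\le1$, $p>1/\beta$ and $x_0>0$. For $0<\alpha<1$ write $C^+_{\alpha}(0,\infty)$ for the set of nonnegative continuous functions $x$ on $(0,\infty)$ such that $t^{\alpha}x(t)$ extends to a nonnegative continuous function on $[0,\infty)$, and $L^p_{\mathrm{loc}}[0,\infty)$ for the functions that are $L^p$ on every bounded subinterval of $[0,\infty)$. Put $$I_{0^+}^{\alpha}\rho(t)=\frac1{\Gamma(\alpha)}\int_0^t\frac{\rho(s)}{(t-s)^{1-\alpha}}\,ds,\qquad D_{0^+}^{\beta}\rho(t)=\frac{d}{dt}I_{0^+}^{1-\beta}\rho(t).$$ Let $l$ be a nonnegative function on $(0,\infty)$ with $t^{(1-\mu)(1-\beta)}l(t)\in C(0,\infty)\cap L^p_{\mathrm{loc}}[0,\infty)$, and suppose that there is a constant $K\ge0$ with $t^{\gamma}l(t)\le K$ for all $t\in[1,\infty)$. Let $k$ be a nonnegative function on $(0,\infty)$ with $t^{1-\beta}k(t)\in C(0,\infty)\cap L^p_{\mathrm{loc}}[0,\infty)$ and $\lim_{t\to\infty}t^{\beta}k(t)=b\ge0$. Let $\phi$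 be a nonnegative continuous function on $[0,\infty)$, and suppose that there is a constant $M\ge0$ with $|\phi(u)|\le M u^{\mu}$ for all $u\in[0,\infty)$ (with the convention $0^0=1$). Then the Riemann–Liouville fractional initial value problem $$D_{0^+}^{\beta}x(t)=l(t)\,\phi(x(t))+k(t)\quad(t\in(0,\infty)),\qquad \lim_{t\to0^+}t^{1-\beta}x(t)=x_0,$$ has at least one solution $x\in C^+_{1-\beta}(0,\infty)$ with $$\lim_{t\to\infty}x(t)=\frac{b\pi}{\Gamma(\beta)\sin(\beta\pi)}.$$ Here a solution is a function $x$, integrable on $(0,T]$ for every $T>0$, such that for every $T>0$ the function $I_{0^+}^{1-\beta}x$ coincides on $(0,T]$ with an absolutely continuous function on $[0,T]$, the differential equation holds at every $t>0$, and the initial condition holds. -/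

import Mathlib

open Set Filter Topology MeasureTheory

/-- The Riemann-Liouville fractional integral of order `β`,
`I^β ρ (t) = 1 / Γ(β) * ∫₀ᵗ ρ(s) / (t - s)^(1 - β) ds`. -/
noncomputable def rlIntegral (β : ℝ) (ρ : ℝ → ℝ) (t : ℝ) : ℝ :=
  1 / Real.Gamma β * ∫ s in (0 : ℝ)..t, ρ s / (t - s) ^ (1 - β)

/-- `ρ` has Riemann-Liouville derivative `d` of order `β` at the point `t`: the function
`I^(1 - β) ρ` is differentiable at `t` with derivative `d`. -/
def HasRLDerivAt (β : ℝ) (ρ : ℝ → ℝ) (d t : ℝ) : Prop :=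
  HasDerivAt (rlIntegral (1 - β) ρ) d t

/-- The function `f`, regarded on `(0, ∞)`, is absolutely continuous up to `0`: for every `T > 0`
it agrees on `(0, T]` with an absolutely continuous function on `[0, T]`. -/
def IsAbsContUpToZero (f : ℝ → ℝ) : Prop :=
  ∀ T : ℝ, 0 < T → ∃ g : ℝ → ℝ, AbsolutelyContinuousOnInterval g 0 T ∧ EqOn g f (Ioc 0 T)

/-- The class `C⁺_α(0, ∞)` of nonnegative continuous functions `x` on `(0, ∞)` such that
`t ^ α * x t` belongs to `C⁺[0, ∞)`, that is, extends to a nonnegative continuous function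
on `[0, ∞)`. Values of `x` outside `(0, ∞)` play no role. -/
def CPlusWeighted (α : ℝ) : Set (ℝ → ℝ) :=
  {x | ContinuousOn x (Ioi 0) ∧ (∀ t, 0 < t → 0 ≤ x t) ∧
    ∃ g : ℝ → ℝ, ContinuousOn g (Ici 0) ∧ (∀ t, 0 ≤ t → 0 ≤ g t) ∧
      ∀ t, 0 < t → g t = t ^ α * x t}

/-- The class `L^p_loc[0, ∞)` for a real exponent `p`: functions that are `L^p` on every bounded
interval `[0, T]`. -/
def MemLpLoc (p : ℝ) (f : ℝ → ℝ) : Prop :=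
  ∀ T : ℝ, 0 < T → MemLp f (ENNReal.ofReal p) (volume.restrict (Icc 0 T))

/-- `x` solves the initial value problem
`D^β x (t) = l(t) φ(x(t)) + k(t)` for all `t > 0`, `lim_{t → 0+} t^(1 - β) x(t) = x₀`,
where `D^β` is the Riemann-Liouville derivative of order `β`: `x` is integrable on bounded
intervals (the domain of the fractional integral), `I^(1 - β) x` is absolutely continuous, the
equation holds at every point of `(0, ∞)`, and the initial condition holds. -/
structure IsRLSolution (β x₀ : ℝ) (l k φ : ℝ → ℝ) (x : ℝ → ℝ) : Prop where
  integrableOn : ∀ T : ℝ, 0 < T → IntegrableOn x (Ioc 0 T)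
  absCont : IsAbsContUpToZero (rlIntegral (1 - β) x)
  equation : ∀ t : ℝ, 0 < t → HasRLDerivAt β x (l t * φ (x t) + k t) t
  initial : Tendsto (fun t : ℝ => t ^ (1 - β) * x t) (𝓝[>] 0) (𝓝 x₀)

/-! With `u t = t ^ (1 - β) * x t` the problem becomes a Volterra equation `u = x₀ + c * t ^ (1 - β)
* ∫ (t - s) ^ (β - 1) * F s (u s)`, `c = 1 / Γ(β)`. Since `μ ≤ 1`, `F s u ≤ H s * (1 + u)`, where
`H` is `s ^ (β - 1)` times an `L^p` function. The condition `p > 1 / β` leaves spare room in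
Hölder's inequality: the kernel may be made more singular by a factor `(t - s) ^ (-δ)`
(`exists_abelBound_of_memLp`). That `δ` gives both equicontinuity and an exponential a priori bound.

Existence follows Tonelli's scheme: equations with delay `1 / (n + 1)` are solved by finitely many
iterations, and a subsequence converges pointwise by compactness and equicontinuity
(`AbelVolterra.exists_solution`). The semigroup law for fractional integrals turns the integral
equation back into the differential one (`integral_abelIntegral_mul`).

For the limit, `γ > β` makes the feedback term `o(1) * (1 + x) * s ^ (-β)`. A maximum argument then
bounds `x` (`exists_bound_of_abelIntegral_eq`), so the right-hand side is asymptotic to `b * s ^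
(-β)` in the sense that `t ^ β` times it tends to `b`. The Abel integral of `s ^ (-β)` is the
constant `π / sin(πβ)`, which produces the limit (`tendsto_abelIntegral`). -/

/-! ### Beta integrals on `(0, t)`. -/

theorem setIntegral_sub_rpow_mul_rpow {a c t : ℝ} (ha : -1 < a) (hc : -1 < c) (ht : 0 < t) :
    ∫ s in Ioo 0 t, (t - s) ^ a * s ^ c =
      t ^ (a + c + 1) * ProbabilityTheory.beta (c + 1) (a + 1) := by
  have key := Complex.betaIntegral_scaled (c + 1 : ℂ) (a + 1 : ℂ) ht
  have hB : Complex.betaIntegral (c + 1 : ℂ) (a + 1 : ℂ)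
      = ((ProbabilityTheory.beta (c + 1) (a + 1) : ℝ) : ℂ) := by
    rw [Complex.betaIntegral_eq_Gamma_mul_div _ _ (by simpa using by linarith)
      (by simpa using by linarith), ProbabilityTheory.beta]
    have h1 : (c + 1 : ℂ) = ((c + 1 : ℝ) : ℂ) := by push_cast; rfl
    have h2 : (a + 1 : ℂ) = ((a + 1 : ℝ) : ℂ) := by push_cast; rfl
    rw [h1, h2, ← Complex.ofReal_add, Complex.Gamma_ofReal, Complex.Gamma_ofReal,
      Complex.Gamma_ofReal]
    push_cast; rfl
  rw [hB, intervalIntegral.integral_of_le ht.le, integral_Ioc_eq_integral_Ioo] at key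
  have hL : ∫ x in Ioo 0 t, (x : ℂ) ^ ((c + 1 : ℂ) - 1) * ((t : ℂ) - x) ^ ((a + 1 : ℂ) - 1)
      = ∫ x in Ioo 0 t, (((t - x) ^ a * x ^ c : ℝ) : ℂ) := by
    refine setIntegral_congr_fun measurableSet_Ioo fun x hx => ?_
    simp only [add_sub_cancel_right]
    rw [← Complex.ofReal_sub, ← Complex.ofReal_cpow hx.1.le,
      ← Complex.ofReal_cpow (sub_nonneg.2 hx.2.le), mul_comm]
    push_cast; rfl
  rw [hL, integral_complex_ofReal] at key
  have hR : (t : ℂ) ^ ((c + 1 : ℂ) + (a + 1) - 1) = ((t ^ (a + c + 1) : ℝ) : ℂ) := by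
    rw [Complex.ofReal_cpow ht.le]; congr 1; push_cast; ring
  rw [hR] at key
  exact_mod_cast key

theorem integrableOn_sub_rpow_mul_rpow {a c t : ℝ} (ha : -1 < a) (hc : -1 < c) (ht : 0 < t) :
    IntegrableOn (fun s => (t - s) ^ a * s ^ c) (Ioo 0 t) := by
  -- The Bochner integral of a non-integrable function is `0` by definition, so the nonzero Beta
  -- value already proves integrability.
  refine not_imp_comm.1 integral_undef ?_
  rw [setIntegral_sub_rpow_mul_rpow ha hc ht]
  exact (mul_pos (Real.rpow_pos_of_pos ht _)
    (ProbabilityTheory.beta_pos (by linarith) (by linarith))).ne'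

/-! ### Abel bounds for weights of `L^p` type. -/

/-- A weight `H` on `(0, T)` whose Abel-type integrals with the kernel `(t - s) ^ (β - 1 - δ)` are
finite and bounded by `C * t ^ (β - 1 + δ)`. -/
structure AbelBound (β δ C T : ℝ) (H : ℝ → ℝ) : Prop where
  nonneg : ∀ s ∈ Ioo 0 T, 0 ≤ H s
  const_nonneg : 0 ≤ C
  integrableOn : ∀ t ∈ Ioc 0 T, IntegrableOn (fun s => (t - s) ^ (β - 1 - δ) * H s) (Ioo 0 t)
  bound : ∀ t ∈ Ioc 0 T, ∫ s in Ioo 0 t, (t - s) ^ (β - 1 - δ) * H s ≤ C * t ^ (β - 1 + δ)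

/-- Hölder's inequality pairs `h` with `(t - s) ^ (β - 1 - δ) * s ^ (β - 1)`, whose `q`-th power is
a Beta integrand. Both exponents must exceed `-1 / q = 1 / p - 1`; this needs `δ < β - 1 / p`, and
`δ` is half of that gap. -/
theorem exists_abelBound_of_memLp {β p T : ℝ} {h : ℝ → ℝ} (hβ : 0 < β) (hβ1 : β < 1)
    (hp : 1 / β < p) (h0 : ∀ s ∈ Ioo 0 T, 0 ≤ h s)
    (hh : MemLp h (ENNReal.ofReal p) (volume.restrict (Ioo 0 T))) :
    ∃ C, AbelBound β ((β - 1 / p) / 2) C T (fun s => s ^ (β - 1) * h s) := by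
  have hp1 : 1 < p := lt_trans (by rw [lt_div_iff₀ hβ]; linarith) hp
  have hp0 : 0 < p := by linarith
  have hpβ : 1 / p < β := by
    rw [div_lt_iff₀ hp0]; rw [div_lt_iff₀ hβ] at hp; linarith
  set δ := (β - 1 / p) / 2 with hδ
  obtain ⟨q, hq⟩ : ∃ q : ℝ, q.HolderConjugate p :=
    ⟨_, (Real.HolderConjugate.conjExponent hp1).symm⟩
  have hq0 : 0 < q := hq.pos
  have hqp : 1 / q = 1 - 1 / p := by
    have := hq.inv_add_inv_eq_one
    simp only [one_div]; linarith
  have hexp : ∀ e : ℝ, 1 / p - 1 < e → -1 < e * q := fun e he => by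
    have : -(1 / q) < e := by rw [hqp]; linarith
    have := mul_lt_mul_of_pos_right this hq0
    rwa [neg_mul, one_div_mul_cancel hq0.ne'] at this
  have ha : -1 < (β - 1 - δ) * q := hexp _ (by rw [hδ]; linarith)
  have hc : -1 < (β - 1) * q := hexp _ (by linarith)
  set P := (∫ s in Ioo 0 T, h s ^ p) ^ (1 / p)
  set B := ProbabilityTheory.beta ((β - 1) * q + 1) ((β - 1 - δ) * q + 1)
  have hB : 0 < B := ProbabilityTheory.beta_pos (by linarith) (by linarith)
  have hP : 0 ≤ P := Real.rpow_nonneg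
    (setIntegral_nonneg measurableSet_Ioo fun s hs => Real.rpow_nonneg (h0 s hs) _) _
  have hInt : IntegrableOn (fun s => h s ^ p) (Ioo 0 T) := by
    have := hh.integrable_norm_rpow (by simpa using hp0) (by simp)
    rw [ENNReal.toReal_ofReal hp0.le] at this
    refine IntegrableOn.congr_fun this (fun s hs => ?_) measurableSet_Ioo
    simp only [Real.norm_of_nonneg (h0 s hs)]
  have main : ∀ t ∈ Ioc 0 T,
      IntegrableOn (fun s => (t - s) ^ (β - 1 - δ) * (s ^ (β - 1) * h s)) (Ioo 0 t) ∧
      ∫ s in Ioo 0 t, (t - s) ^ (β - 1 - δ) * (s ^ (β - 1) * h s) ≤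
        B ^ (1 / q) * P * t ^ (β - 1 + δ) := by
    intro t ht
    have hsub : Ioo 0 t ⊆ Ioo 0 T := Ioo_subset_Ioo le_rfl ht.2
    set κ : ℝ → ℝ := fun s => (t - s) ^ (β - 1 - δ) * s ^ (β - 1) with hκ
    have hκ0 : ∀ s ∈ Ioo 0 t, 0 ≤ κ s := fun s hs =>
      mul_nonneg (Real.rpow_nonneg (sub_nonneg.2 hs.2.le) _) (Real.rpow_nonneg hs.1.le _)
    have hκq : ∀ s ∈ Ioo 0 t, κ s ^ q = (t - s) ^ ((β - 1 - δ) * q) * s ^ ((β - 1) * q) := by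
      intro s hs
      rw [hκ, Real.mul_rpow (Real.rpow_nonneg (sub_nonneg.2 hs.2.le) _)
        (Real.rpow_nonneg hs.1.le _), ← Real.rpow_mul (sub_nonneg.2 hs.2.le),
        ← Real.rpow_mul hs.1.le]
    have hκm : MemLp κ (ENNReal.ofReal q) (volume.restrict (Ioo 0 t)) := by
      have hm : Measurable κ := by fun_prop
      rw [← integrable_norm_rpow_iff hm.aestronglyMeasurable (by simpa using hq0) (by simp),
        ENNReal.toReal_ofReal hq0.le]
      refine IntegrableOn.congr_fun (integrableOn_sub_rpow_mul_rpow ha hc ht.1) (fun s hs => ?_)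
        measurableSet_Ioo
      simp only [Real.norm_of_nonneg (hκ0 s hs), hκq s hs]
    have hht : MemLp h (ENNReal.ofReal p) (volume.restrict (Ioo 0 t)) :=
      hh.mono_measure (Measure.restrict_mono hsub le_rfl)
    have hfun : (fun s => (t - s) ^ (β - 1 - δ) * (s ^ (β - 1) * h s)) = fun s => κ s * h s := by
      funext s; simp only [hκ]; ring
    rw [hfun]
    have : (ENNReal.ofReal q).HolderConjugate (ENNReal.ofReal p) := hq.ennrealOfReal
    refine ⟨hκm.integrable_mul hht, ?_⟩
    refine (integral_mul_le_Lp_mul_Lq_of_nonneg hq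
      ((ae_restrict_iff' measurableSet_Ioo).2 (Eventually.of_forall hκ0))
      ((ae_restrict_iff' measurableSet_Ioo).2 (Eventually.of_forall fun s hs => h0 s (hsub hs)))
      hκm hht).trans ?_
    rw [setIntegral_congr_fun measurableSet_Ioo hκq, setIntegral_sub_rpow_mul_rpow ha hc ht.1,
      Real.mul_rpow (Real.rpow_nonneg ht.1.le _) hB.le, ← Real.rpow_mul ht.1.le]
    -- Scaling gives the exponent `β - 1 + (β - 1 / p) - δ`, and `β - 1 / p = 2 * δ`.
    have he : ((β - 1 - δ) * q + (β - 1) * q + 1) * (1 / q) = β - 1 + δ := by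
      have : ((β - 1 - δ) * q + (β - 1) * q + 1) * (1 / q) = (β - 1 - δ) + (β - 1) + 1 / q := by
        field_simp
      rw [this, hqp, hδ]; ring
    rw [he]
    have hle : (∫ s in Ioo 0 t, h s ^ p) ^ (1 / p) ≤ P := by
      refine Real.rpow_le_rpow (setIntegral_nonneg measurableSet_Ioo fun s hs =>
        Real.rpow_nonneg (h0 s (hsub hs)) _) ?_ (by positivity)
      refine setIntegral_mono_set hInt ?_ (LE.le.eventuallyLE hsub)
      exact (ae_restrict_iff' measurableSet_Ioo).2
        (Eventually.of_forall fun s hs => Real.rpow_nonneg (h0 s hs) _)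
    calc t ^ (β - 1 + δ) * B ^ (1 / q) * (∫ s in Ioo 0 t, h s ^ p) ^ (1 / p)
        ≤ t ^ (β - 1 + δ) * B ^ (1 / q) * P := by
          have := ht.1
          gcongr
      _ = _ := by ring
  exact ⟨B ^ (1 / q) * P, fun s hs => mul_nonneg (Real.rpow_nonneg hs.1.le _) (h0 s hs),
    by positivity, fun t ht => (main t ht).1, fun t ht => (main t ht).2⟩

/-! ### The Abel integral and pointwise kernel inequalities. -/

/-- The Abel integral `∫₀ᵗ (t - s) ^ (β - 1) * f s ds`. -/
noncomputable def abelIntegral (β : ℝ) (f : ℝ → ℝ) (t : ℝ) : ℝ :=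
  ∫ s in Ioo 0 t, (t - s) ^ (β - 1) * f s

theorem rpow_le_rpow_mul_rpow_sub {a δ x y : ℝ} (hδ : 0 ≤ δ) (hx : 0 < x) (hxy : x ≤ y) :
    x ^ a ≤ y ^ δ * x ^ (a - δ) := by
  calc x ^ a = x ^ δ * x ^ (a - δ) := by rw [← Real.rpow_add hx]; congr 1; ring
    _ ≤ y ^ δ * x ^ (a - δ) := by gcongr

/-- With `r = x / y`, the difference is `x ^ (β - 1) * (1 - r ^ (1 - β))`, and `1 - r ^ (1 - β) ≤ 1
- r ≤ (1 - r) ^ δ ≤ ((y - x) / x) ^ δ`. An increment of the kernel is thus paid for by `δ` extra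
orders of singularity. -/
theorem rpow_sub_rpow_le_mul {β δ x y : ℝ} (hβ : 0 < β) (hδ : 0 ≤ δ) (hδ1 : δ ≤ 1)
    (hx : 0 < x) (hxy : x ≤ y) :
    x ^ (β - 1) - y ^ (β - 1) ≤ (y - x) ^ δ * x ^ (β - 1 - δ) := by
  have hy : 0 < y := hx.trans_le hxy
  set r := x / y with hr
  have hr0 : 0 < r := div_pos hx hy
  have hr1 : r ≤ 1 := (div_le_one hy).2 hxy
  have h1 : y ^ (β - 1) = x ^ (β - 1) * r ^ (1 - β) := by
    rw [hr, Real.div_rpow hx.le hy.le, show (1 - β) = -(β - 1) by ring, Real.rpow_neg hx.le,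
      Real.rpow_neg hy.le]
    have := (Real.rpow_pos_of_pos hx (β - 1)).ne'
    have := (Real.rpow_pos_of_pos hy (β - 1)).ne'
    field_simp
  have h2 : r ≤ r ^ (1 - β) := by
    simpa using Real.rpow_le_rpow_of_exponent_ge hr0 hr1 (show 1 - β ≤ 1 by linarith)
  have h3 : (1 - r) ≤ (1 - r) ^ δ := by
    rcases (sub_nonneg.2 hr1).eq_or_lt with h | h
    · rw [← h]; exact Real.rpow_nonneg le_rfl _
    · simpa using Real.rpow_le_rpow_of_exponent_ge h (by linarith) hδ1
  have h4 : (1 - r) ^ δ ≤ (y - x) ^ δ * x ^ (-δ) := by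
    have e : 1 - r = (y - x) / y := by rw [hr]; field_simp
    rw [e, Real.rpow_neg hx.le, ← div_eq_mul_inv, ← Real.div_rpow (by linarith) hx.le]
    refine Real.rpow_le_rpow (div_nonneg (by linarith) hy.le) ?_ hδ
    exact div_le_div_of_nonneg_left (by linarith) hx hxy
  have hxp := Real.rpow_pos_of_pos hx (β - 1)
  calc x ^ (β - 1) - y ^ (β - 1) = x ^ (β - 1) * (1 - r ^ (1 - β)) := by rw [h1]; ring
    _ ≤ x ^ (β - 1) * ((y - x) ^ δ * x ^ (-δ)) := by gcongr; linarith
    _ = _ := by rw [sub_eq_add_neg (β - 1) δ, Real.rpow_add hx]; ring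

theorem exp_neg_le_rpow_neg {δ x : ℝ} (hδ : 0 ≤ δ) (hδ1 : δ ≤ 1) (hx : 0 < x) :
    Real.exp (-x) ≤ x ^ (-δ) := by
  rw [Real.exp_neg, Real.rpow_neg hx.le]
  refine inv_anti₀ (Real.rpow_pos_of_pos hx _) ?_
  rcases le_total x 1 with h | h
  · exact (Real.rpow_le_one hx.le h hδ).trans (Real.one_le_exp hx.le)
  · calc x ^ δ ≤ x ^ (1 : ℝ) := Real.rpow_le_rpow_of_exponent_le h hδ1
      _ = x := Real.rpow_one x
      _ ≤ Real.exp x := by linarith [Real.add_one_le_exp x]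

/-! ### Estimates for Abel integrals, uniform over all integrands dominated by the weight. -/

namespace AbelBound

variable {β δ C T : ℝ} {H f : ℝ → ℝ}

theorem const_mul (hA : AbelBound β δ C T H) {E : ℝ} (hE : 0 ≤ E) :
    AbelBound β δ (E * C) T (fun s => E * H s) where
  nonneg s hs := mul_nonneg hE (hA.nonneg s hs)
  const_nonneg := mul_nonneg hE hA.const_nonneg
  integrableOn t ht := by
    refine IntegrableOn.congr_fun ((hA.integrableOn t ht).const_mul E) (fun s _ => ?_)
      measurableSet_Ioo
    ring
  bound t ht := by
    have e : (fun s => (t - s) ^ (β - 1 - δ) * (E * H s)) =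
        fun s => E * ((t - s) ^ (β - 1 - δ) * H s) := by funext s; ring
    rw [e, integral_const_mul, mul_assoc]
    exact mul_le_mul_of_nonneg_left (hA.bound t ht) hE

theorem kernel_mul_integrableOn (hA : AbelBound β δ C T H) (hδ : 0 ≤ δ)
    (hf : AEStronglyMeasurable f (volume.restrict (Ioo 0 T)))
    (hfH : ∀ s ∈ Ioo 0 T, |f s| ≤ H s) {t : ℝ} (ht : t ∈ Ioc 0 T) :
    IntegrableOn (fun s => (t - s) ^ (β - 1) * f s) (Ioo 0 t) := by
  have hsub : Ioo 0 t ⊆ Ioo 0 T := Ioo_subset_Ioo le_rfl ht.2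
  refine Integrable.mono' ((hA.integrableOn t ht).const_mul (t ^ δ)) ?_ ?_
  · exact (Measurable.aestronglyMeasurable (by fun_prop)).mul
      (hf.mono_measure (Measure.restrict_mono hsub le_rfl))
  · refine (ae_restrict_iff' measurableSet_Ioo).2 (Eventually.of_forall fun s hs => ?_)
    have h1 : 0 < t - s := sub_pos.2 hs.2
    have h2 := rpow_le_rpow_mul_rpow_sub (a := β - 1) hδ h1 (show t - s ≤ t by linarith [hs.1])
    have h3 := hfH s (hsub hs)
    rw [Real.norm_eq_abs, abs_mul, abs_of_pos (Real.rpow_pos_of_pos h1 _), ← mul_assoc]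
    exact mul_le_mul h2 h3 (abs_nonneg _) ((Real.rpow_nonneg h1.le _).trans h2)

theorem abs_abelIntegral_le (hA : AbelBound β δ C T H) (hδ : 0 ≤ δ)
    (hfH : ∀ s ∈ Ioo 0 T, |f s| ≤ H s) {t : ℝ} (ht : t ∈ Ioc 0 T) :
    |abelIntegral β f t| ≤ C * t ^ (β - 1 + 2 * δ) := by
  have hsub : Ioo 0 t ⊆ Ioo 0 T := Ioo_subset_Ioo le_rfl ht.2
  calc |abelIntegral β f t| ≤ ∫ s in Ioo 0 t, t ^ δ * ((t - s) ^ (β - 1 - δ) * H s) := by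
        rw [← Real.norm_eq_abs]
        refine norm_integral_le_of_norm_le ((hA.integrableOn t ht).const_mul _) ?_
        refine (ae_restrict_iff' measurableSet_Ioo).2 (Eventually.of_forall fun s hs => ?_)
        have h1 : 0 < t - s := sub_pos.2 hs.2
        have h2 := rpow_le_rpow_mul_rpow_sub (a := β - 1) hδ h1 (show t - s ≤ t by linarith [hs.1])
        rw [Real.norm_eq_abs, abs_mul, abs_of_pos (Real.rpow_pos_of_pos h1 _), ← mul_assoc]
        exact mul_le_mul h2 (hfH s (hsub hs)) (abs_nonneg _) ((Real.rpow_nonneg h1.le _).trans h2)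
    _ ≤ t ^ δ * (C * t ^ (β - 1 + δ)) := by
        rw [integral_const_mul]
        exact mul_le_mul_of_nonneg_left (hA.bound t ht) (Real.rpow_nonneg ht.1.le _)
    _ = C * (t ^ (β - 1 + δ) * t ^ δ) := by ring
    _ = _ := by rw [← Real.rpow_add ht.1]; congr 2; ring

/-- The integral is split at `t`. On `(0, t)` the kernel difference yields `(t' - t) ^ δ`; on `[t,
t')` the same factor appears because `t' - s ≤ t' - t`. -/
theorem abs_abelIntegral_sub_le (hA : AbelBound β δ C T H) (hβ : 0 < β) (hβ1 : β < 1)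
    (hδ : 0 ≤ δ) (hδ1 : δ ≤ 1)
    (hf : AEStronglyMeasurable f (volume.restrict (Ioo 0 T)))
    (hfH : ∀ s ∈ Ioo 0 T, |f s| ≤ H s) {t t' : ℝ} (ht : 0 < t) (htt : t ≤ t') (ht' : t' ≤ T) :
    |abelIntegral β f t' - abelIntegral β f t| ≤
      (t' - t) ^ δ * (C * t ^ (β - 1 + δ) + C * t' ^ (β - 1 + δ)) := by
  have htm : t ∈ Ioc 0 T := ⟨ht, htt.trans ht'⟩
  have htm' : t' ∈ Ioc 0 T := ⟨ht.trans_le htt, ht'⟩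
  have hd : Disjoint (Ioo 0 t) (Ico t t') :=
    Set.disjoint_left.2 fun s hs hs' => absurd hs.2 (not_lt.2 hs'.1)
  have hu : Ioo 0 t ∪ Ico t t' = Ioo 0 t' := Ioo_union_Ico_eq_Ioo ht htt
  have hI' := hA.kernel_mul_integrableOn hδ hf hfH htm'
  have hI := hA.kernel_mul_integrableOn hδ hf hfH htm
  have hI1 : IntegrableOn (fun s => (t' - s) ^ (β - 1) * f s) (Ioo 0 t) :=
    hI'.mono_set (Ioo_subset_Ioo le_rfl htt)
  have hsub2 : Ico t t' ⊆ Ioo 0 t' := fun s hs => ⟨ht.trans_le hs.1, hs.2⟩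
  have hI2 := hI'.mono_set hsub2
  have hp1 : ∀ s ∈ Ioo 0 t, ‖(t' - s) ^ (β - 1) * f s - (t - s) ^ (β - 1) * f s‖ ≤
      (t' - t) ^ δ * ((t - s) ^ (β - 1 - δ) * H s) := by
    intro s hs
    have h1 : 0 < t - s := sub_pos.2 hs.2
    have h2 := rpow_sub_rpow_le_mul hβ hδ hδ1 h1 (show t - s ≤ t' - s by linarith)
    have h3 : (t' - s) ^ (β - 1) ≤ (t - s) ^ (β - 1) :=
      Real.rpow_le_rpow_of_nonpos h1 (by linarith) (by linarith)
    rw [show t' - s - (t - s) = t' - t by ring] at h2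
    rw [← sub_mul, norm_mul, Real.norm_eq_abs, Real.norm_eq_abs, abs_sub_comm,
      abs_of_nonneg (sub_nonneg.2 h3), ← mul_assoc]
    exact mul_le_mul h2 (hfH s ⟨hs.1, hs.2.trans_le htm.2⟩) (abs_nonneg _)
      ((sub_nonneg.2 h3).trans h2)
  have hp2 : ∀ s ∈ Ico t t', ‖(t' - s) ^ (β - 1) * f s‖ ≤
      (t' - t) ^ δ * ((t' - s) ^ (β - 1 - δ) * H s) := by
    intro s hs
    have h1 : 0 < t' - s := sub_pos.2 hs.2
    have h2 := rpow_le_rpow_mul_rpow_sub (a := β - 1) hδ h1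
      (show t' - s ≤ t' - t by linarith [hs.1])
    rw [Real.norm_eq_abs, abs_mul, abs_of_pos (Real.rpow_pos_of_pos h1 _), ← mul_assoc]
    exact mul_le_mul h2 (hfH s ⟨ht.trans_le hs.1, hs.2.trans_le ht'⟩) (abs_nonneg _)
      ((Real.rpow_nonneg h1.le _).trans h2)
  have e : abelIntegral β f t' - abelIntegral β f t =
      (∫ s in Ioo 0 t, ((t' - s) ^ (β - 1) * f s - (t - s) ^ (β - 1) * f s)) +
        ∫ s in Ico t t', (t' - s) ^ (β - 1) * f s := by
    rw [integral_sub hI1 hI, abelIntegral, abelIntegral, ← hu,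
      setIntegral_union hd measurableSet_Ico hI1 hI2]
    ring
  rw [e, mul_add]
  have hpow : 0 ≤ (t' - t) ^ δ := Real.rpow_nonneg (sub_nonneg.2 htt) _
  refine (abs_add_le _ _).trans (add_le_add ?_ ?_)
  · rw [← Real.norm_eq_abs]
    refine (norm_integral_le_of_norm_le ((hA.integrableOn t htm).const_mul ((t' - t) ^ δ))
      ((ae_restrict_iff' measurableSet_Ioo).2 (Eventually.of_forall hp1))).trans ?_
    rw [integral_const_mul]
    exact mul_le_mul_of_nonneg_left (hA.bound t htm) hpow
  · rw [← Real.norm_eq_abs]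
    refine (norm_integral_le_of_norm_le
      (((hA.integrableOn t' htm').mono_set hsub2).const_mul ((t' - t) ^ δ))
      ((ae_restrict_iff' measurableSet_Ico).2 (Eventually.of_forall hp2))).trans ?_
    rw [integral_const_mul]
    refine mul_le_mul_of_nonneg_left (le_trans ?_ (hA.bound t' htm')) hpow
    refine setIntegral_mono_set (hA.integrableOn t' htm') ?_ (LE.le.eventuallyLE hsub2)
    refine (ae_restrict_iff' measurableSet_Ioo).2 (Eventually.of_forall fun s hs => ?_)
    exact mul_nonneg (Real.rpow_nonneg (sub_nonneg.2 hs.2.le) _)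
      (hA.nonneg s ⟨hs.1, hs.2.trans_le ht'⟩)

/-- On `(0, T)` the kernel is bounded below by `T ^ (β - 1)`, so it can be divided out. -/
theorem integrableOn_of_le (hA : AbelBound β δ C T H) (hβ1 : β < 1) (hδ : 0 ≤ δ)
    (hf : AEStronglyMeasurable f (volume.restrict (Ioo 0 T)))
    (hfH : ∀ s ∈ Ioo 0 T, |f s| ≤ H s) (hT : 0 < T) : IntegrableOn f (Ioo 0 T) := by
  refine Integrable.mono' ((hA.kernel_mul_integrableOn hδ hf hfH ⟨hT, le_rfl⟩).norm.const_mul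
    (T ^ (1 - β))) hf ?_
  refine (ae_restrict_iff' measurableSet_Ioo).2 (Eventually.of_forall fun s hs => ?_)
  have h1 : 0 < T - s := sub_pos.2 hs.2
  have h2 : T ^ (β - 1) ≤ (T - s) ^ (β - 1) :=
    Real.rpow_le_rpow_of_nonpos h1 (by linarith [hs.1]) (by linarith)
  have h3 : 1 ≤ T ^ (1 - β) * (T - s) ^ (β - 1) := by
    calc (1 : ℝ) = T ^ (1 - β) * T ^ (β - 1) := by
          rw [← Real.rpow_add hT]; simp
      _ ≤ _ := by gcongr
  rw [norm_mul, ← mul_assoc, Real.norm_of_nonneg (Real.rpow_nonneg h1.le _)]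
  exact le_mul_of_one_le_left (norm_nonneg _) h3

/-- From `exp (-λ(t - s)) ≤ (λ(t - s)) ^ (-δ)`, the spare `δ` becomes a factor `λ ^ (-δ)`, small for
large `λ`: the Bielecki weight in place of a fractional Gronwall inequality. -/
theorem abelIntegral_exp_mul_le (hA : AbelBound β δ C T H) (hδ : 0 ≤ δ) (hδ1 : δ ≤ 1) {lam : ℝ}
    (hl : 0 < lam) (hfH : ∀ s ∈ Ioo 0 T, |f s| ≤ H s * Real.exp (lam * s)) {t : ℝ}
    (ht : t ∈ Ioc 0 T) :
    |abelIntegral β f t| ≤ Real.exp (lam * t) * lam ^ (-δ) * (C * t ^ (β - 1 + δ)) := by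
  have hsub : Ioo 0 t ⊆ Ioo 0 T := Ioo_subset_Ioo le_rfl ht.2
  rw [← Real.norm_eq_abs]
  refine (norm_integral_le_of_norm_le ((hA.integrableOn t ht).const_mul
    (Real.exp (lam * t) * lam ^ (-δ))) ?_).trans ?_
  · refine (ae_restrict_iff' measurableSet_Ioo).2 (Eventually.of_forall fun s hs => ?_)
    have h1 : 0 < t - s := sub_pos.2 hs.2
    have hH := hA.nonneg s (hsub hs)
    have h2 := exp_neg_le_rpow_neg hδ hδ1 (mul_pos hl h1)
    rw [Real.mul_rpow hl.le h1.le] at h2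
    have h3 : Real.exp (lam * s) = Real.exp (lam * t) * Real.exp (-(lam * (t - s))) := by
      rw [← Real.exp_add]; congr 1; ring
    have hp := Real.rpow_pos_of_pos h1 (β - 1)
    rw [norm_mul, Real.norm_of_nonneg hp.le]
    calc (t - s) ^ (β - 1) * ‖f s‖
        ≤ (t - s) ^ (β - 1) * (H s * (Real.exp (lam * t) * (lam ^ (-δ) * (t - s) ^ (-δ)))) := by
          refine mul_le_mul_of_nonneg_left ((hfH s (hsub hs)).trans ?_) hp.le
          rw [h3]
          gcongr
      _ = Real.exp (lam * t) * lam ^ (-δ) * ((t - s) ^ (β - 1) * (t - s) ^ (-δ) * H s) := by ring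
      _ = _ := by rw [← Real.rpow_add h1]; rfl
  · rw [integral_const_mul]
    exact mul_le_mul_of_nonneg_left (hA.bound t ht) (by positivity)

/-- Equicontinuity: the neighbourhood of `t₀` is fixed before `f`. At `t₀ = 0` the size bound gives
`C * t ^ (2 * δ)`; at `t₀ > 0` the Hölder increment is used. -/
theorem eventually_abs_sub_lt (hA : AbelBound β δ C T H) (hβ : 0 < β) (hβ1 : β < 1)
    (hδ : 0 < δ) (hδ1 : δ ≤ 1) {t₀ : ℝ} (ht₀ : t₀ ∈ Icc 0 T) {ε : ℝ} (hε : 0 < ε) :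
    ∀ᶠ t in 𝓝[Icc 0 T] t₀, ∀ f : ℝ → ℝ, AEStronglyMeasurable f (volume.restrict (Ioo 0 T)) →
      (∀ s ∈ Ioo 0 T, |f s| ≤ H s) →
      |t ^ (1 - β) * abelIntegral β f t - t₀ ^ (1 - β) * abelIntegral β f t₀| < ε := by
  rcases ht₀.1.eq_or_lt with h0 | h0
  · have hlim : Tendsto (fun t : ℝ => C * t ^ (2 * δ)) (𝓝[Icc 0 T] t₀) (𝓝 0) := by
      have : ContinuousAt (fun t : ℝ => C * t ^ (2 * δ)) t₀ :=
        continuousAt_const.mul (Real.continuousAt_rpow_const _ _ (Or.inr (by linarith)))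
      have h := this.tendsto
      rw [← h0, Real.zero_rpow (by linarith), mul_zero] at h
      rw [← h0]
      exact h.mono_left nhdsWithin_le_nhds
    filter_upwards [hlim.eventually_lt_const hε, self_mem_nhdsWithin] with t ht htm f hf hfH
    rw [← h0, Real.zero_rpow (by linarith), zero_mul, sub_zero]
    rcases htm.1.eq_or_lt with h | h
    · rw [← h, Real.zero_rpow (by linarith), zero_mul, abs_zero]; exact hε
    · refine lt_of_le_of_lt ?_ ht
      rw [abs_mul, abs_of_nonneg (Real.rpow_nonneg htm.1 _)]
      calc t ^ (1 - β) * |abelIntegral β f t|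
          ≤ t ^ (1 - β) * (C * t ^ (β - 1 + 2 * δ)) :=
            mul_le_mul_of_nonneg_left (hA.abs_abelIntegral_le hδ.le hfH ⟨h, htm.2⟩)
              (Real.rpow_nonneg htm.1 _)
        _ = C * (t ^ (1 - β) * t ^ (β - 1 + 2 * δ)) := by ring
        _ = _ := by rw [← Real.rpow_add h]; congr 2; ring
  · have hlim : Tendsto (fun t : ℝ => |t ^ (1 - β) - t₀ ^ (1 - β)| * (C * t₀ ^ (β - 1 + 2 * δ)) +
        t ^ (1 - β) * (|t - t₀| ^ δ * (C * t ^ (β - 1 + δ) + C * t₀ ^ (β - 1 + δ))))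
        (𝓝[Icc 0 T] t₀) (𝓝 0) := by
      have hr : ∀ a : ℝ, ContinuousAt (fun t : ℝ => t ^ a) t₀ := fun a =>
        Real.continuousAt_rpow_const _ _ (Or.inl h0.ne')
      have hd : ContinuousAt (fun t : ℝ => |t - t₀| ^ δ) t₀ :=
        ContinuousAt.rpow_const (by fun_prop) (Or.inr hδ.le)
      have := (((((hr (1 - β)).sub (continuousAt_const (y := t₀ ^ (1 - β)))).abs).mul
        (continuousAt_const (y := C * t₀ ^ (β - 1 + 2 * δ)))).add ((hr (1 - β)).mul (hd.mul
          (((continuousAt_const (y := C)).mul (hr (β - 1 + δ))).add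
            (continuousAt_const (y := C * t₀ ^ (β - 1 + δ))))))).tendsto
      simp only [sub_self, abs_zero, zero_mul, Real.zero_rpow hδ.ne', mul_zero, add_zero,
        Pi.mul_apply, Pi.add_apply, Pi.sub_apply] at this
      exact Tendsto.mono_left this nhdsWithin_le_nhds
    have hpos : ∀ᶠ t in 𝓝[Icc 0 T] t₀, 0 < t :=
      nhdsWithin_le_nhds (lt_mem_nhds h0)
    filter_upwards [hlim.eventually_lt_const hε, self_mem_nhdsWithin, hpos]
      with t ht htm htpos f hf hfH
    refine lt_of_le_of_lt ?_ ht
    have hd : |abelIntegral β f t - abelIntegral β f t₀| ≤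
        |t - t₀| ^ δ * (C * t ^ (β - 1 + δ) + C * t₀ ^ (β - 1 + δ)) := by
      rcases le_total t₀ t with h | h
      · rw [abs_of_nonneg (sub_nonneg.2 h), add_comm (C * _)]
        exact hA.abs_abelIntegral_sub_le hβ hβ1 hδ.le hδ1 hf hfH h0 h htm.2
      · rw [abs_sub_comm, abs_sub_comm t, abs_of_nonneg (sub_nonneg.2 h)]
        exact hA.abs_abelIntegral_sub_le hβ hβ1 hδ.le hδ1 hf hfH htpos h ht₀.2
    have e : t ^ (1 - β) * abelIntegral β f t - t₀ ^ (1 - β) * abelIntegral β f t₀ =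
        (t ^ (1 - β) - t₀ ^ (1 - β)) * abelIntegral β f t₀ +
          t ^ (1 - β) * (abelIntegral β f t - abelIntegral β f t₀) := by ring
    rw [e]
    refine (abs_add_le _ _).trans (add_le_add ?_ ?_)
    · rw [abs_mul]
      exact mul_le_mul_of_nonneg_left (hA.abs_abelIntegral_le hδ.le hfH ⟨h0, ht₀.2⟩)
        (abs_nonneg _)
    · rw [abs_mul, abs_of_nonneg (Real.rpow_nonneg htm.1 _)]
      exact mul_le_mul_of_nonneg_left hd (Real.rpow_nonneg htm.1 _)

end AbelBound

/-! ### Existence for the weighted Abel-Volterra equation. -/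

/-- Structural conditions on the nonlinearity `F` of the weighted Abel-Volterra equation
`u t = x₀ + c * t ^ (1 - β) * ∫₀ᵗ (t - s) ^ (β - 1) * F s (u s) ds`: continuity, positivity and
linear growth with respect to a weight `H` satisfying Abel bounds. -/
structure AbelVolterra (β δ c x₀ : ℝ) (H : ℝ → ℝ) (F : ℝ → ℝ → ℝ) : Prop where
  β_pos : 0 < β
  β_lt_one : β < 1
  δ_pos : 0 < δ
  δ_le_one : δ ≤ 1
  c_nonneg : 0 ≤ c
  x₀_nonneg : 0 ≤ x₀
  abelBound : ∀ T, 0 < T → ∃ C, AbelBound β δ C T H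
  continuousOn : ∀ s, 0 < s → ContinuousOn (F s) (Ici 0)
  nonneg : ∀ s u, 0 < s → 0 ≤ u → 0 ≤ F s u
  le : ∀ s u, 0 < s → 0 ≤ u → F s u ≤ H s * (1 + u)
  continuousOn_comp : ∀ u : ℝ → ℝ, Continuous u → (∀ t, 0 ≤ u t) →
    ContinuousOn (fun s => F s (u s)) (Ioi 0)

/-- The weighted Abel-Volterra operator. -/
noncomputable def volterraOp (β c x₀ : ℝ) (F : ℝ → ℝ → ℝ) (u : ℝ → ℝ) (t : ℝ) : ℝ :=
  x₀ + c * (t ^ (1 - β) * abelIntegral β (fun s => F s (u s)) t)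

namespace AbelVolterra

variable {β δ c x₀ : ℝ} {H : ℝ → ℝ} {F : ℝ → ℝ → ℝ}

theorem volterraOp_zero (hV : AbelVolterra β δ c x₀ H F) (u : ℝ → ℝ) :
    volterraOp β c x₀ F u 0 = x₀ := by
  have := hV.β_lt_one
  rw [volterraOp, Real.zero_rpow (by linarith), zero_mul, mul_zero, add_zero]

theorem weight_nonneg (hV : AbelVolterra β δ c x₀ H F) {s : ℝ} (hs : 0 < s) : 0 ≤ H s := by
  simpa using (hV.nonneg s 0 hs le_rfl).trans (hV.le s 0 hs le_rfl)

theorem abs_le (hV : AbelVolterra β δ c x₀ H F) {s u E : ℝ} (hs : 0 < s) (hu : 0 ≤ u)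
    (huE : u ≤ E) : |F s u| ≤ (1 + E) * H s := by
  rw [abs_of_nonneg (hV.nonneg s u hs hu), mul_comm]
  refine (hV.le s u hs hu).trans (mul_le_mul_of_nonneg_left (by linarith) (hV.weight_nonneg hs))

theorem aestronglyMeasurable (hV : AbelVolterra β δ c x₀ H F) {u : ℝ → ℝ} (hu : Continuous u)
    (hu0 : ∀ t, 0 ≤ u t) (T : ℝ) :
    AEStronglyMeasurable (fun s => F s (u s)) (volume.restrict (Ioo 0 T)) :=
  ((hV.continuousOn_comp u hu hu0).mono Ioo_subset_Ioi_self).aestronglyMeasurable measurableSet_Ioo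

theorem volterraOp_nonneg (hV : AbelVolterra β δ c x₀ H F) {u : ℝ → ℝ} {t : ℝ} (ht : 0 ≤ t)
    (hu0 : ∀ s ∈ Ioo 0 t, 0 ≤ u s) : 0 ≤ volterraOp β c x₀ F u t := by
  have h : 0 ≤ abelIntegral β (fun s => F s (u s)) t :=
    setIntegral_nonneg measurableSet_Ioo fun s hs =>
      mul_nonneg (Real.rpow_nonneg (sub_nonneg.2 hs.2.le) _) (hV.nonneg s _ hs.1 (hu0 s hs))
  have := hV.c_nonneg
  have := hV.x₀_nonneg
  have := Real.rpow_nonneg ht (1 - β)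
  unfold volterraOp
  positivity

theorem eventually_abs_sub_lt (hV : AbelVolterra β δ c x₀ H F) {E T t₀ ε : ℝ} (hE : 0 ≤ E)
    (hT : 0 < T) (ht₀ : t₀ ∈ Icc 0 T) (hε : 0 < ε) :
    ∀ᶠ t in 𝓝[Icc 0 T] t₀, ∀ u : ℝ → ℝ,
      AEStronglyMeasurable (fun s => F s (u s)) (volume.restrict (Ioo 0 T)) →
      (∀ s ∈ Ioo 0 T, 0 ≤ u s ∧ u s ≤ E) →
      |volterraOp β c x₀ F u t - volterraOp β c x₀ F u t₀| < ε := by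
  obtain ⟨C, hC⟩ := hV.abelBound T hT
  have hc := hV.c_nonneg
  have hC' := hC.const_mul (show 0 ≤ 1 + E by linarith)
  filter_upwards [hC'.eventually_abs_sub_lt hV.β_pos hV.β_lt_one hV.δ_pos hV.δ_le_one ht₀
    (show 0 < ε / (c + 1) by positivity)] with t ht u hum hu
  have h := ht (fun s => F s (u s)) hum fun s hs => hV.abs_le hs.1 (hu s hs).1 (hu s hs).2
  rw [lt_div_iff₀ (by linarith)] at h
  have e : volterraOp β c x₀ F u t - volterraOp β c x₀ F u t₀ =
      c * (t ^ (1 - β) * abelIntegral β (fun s => F s (u s)) t -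
        t₀ ^ (1 - β) * abelIntegral β (fun s => F s (u s)) t₀) := by
    simp only [volterraOp]; ring
  rw [e, abs_mul, abs_of_nonneg hc]
  refine lt_of_le_of_lt ?_ h
  rw [mul_comm]
  exact mul_le_mul_of_nonneg_left (by linarith) (abs_nonneg _)

theorem continuousOn_volterraOp (hV : AbelVolterra β δ c x₀ H F) {u : ℝ → ℝ}
    (hum : ∀ T, AEStronglyMeasurable (fun s => F s (u s)) (volume.restrict (Ioo 0 T)))
    (hu0 : ∀ s, 0 ≤ s → 0 ≤ u s) (hub : ∀ T, 0 < T → ∃ E, ∀ s ∈ Icc 0 T, u s ≤ E) :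
    ContinuousOn (volterraOp β c x₀ F u) (Ici 0) := by
  intro t₀ ht₀
  have ht₀' : (0 : ℝ) ≤ t₀ := ht₀
  have hT : 0 < t₀ + 1 := by linarith
  obtain ⟨E, hE⟩ := hub _ hT
  have hE0 : 0 ≤ E := (hu0 0 le_rfl).trans (hE 0 ⟨le_rfl, hT.le⟩)
  have hnhds : 𝓝[Icc 0 (t₀ + 1)] t₀ = 𝓝[Ici 0] t₀ := by
    rw [← Ici_inter_Iic]
    exact nhdsWithin_inter_of_mem' (mem_nhdsWithin_of_mem_nhds (Iic_mem_nhds (by linarith)))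
  rw [ContinuousWithinAt, Metric.tendsto_nhds]
  intro ε hε
  rw [← hnhds]
  filter_upwards [hV.eventually_abs_sub_lt hE0 hT ⟨ht₀', by linarith⟩ hε] with t ht
  rw [Real.dist_eq]
  exact ht u (hum _) fun s hs => ⟨hu0 s hs.1.le, hE s ⟨hs.1.le, hs.2.le⟩⟩

theorem tendsto_volterraOp (hV : AbelVolterra β δ c x₀ H F) {E t : ℝ} (ht : 0 ≤ t)
    {v : ℕ → ℝ → ℝ} {u : ℝ → ℝ}
    (hvm : ∀ n, AEStronglyMeasurable (fun s => F s (v n s)) (volume.restrict (Ioo 0 t)))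
    (hv : ∀ n, ∀ s ∈ Ioo 0 t, 0 ≤ v n s ∧ v n s ≤ E)
    (hlim : ∀ s ∈ Ioo 0 t, Tendsto (fun n => v n s) atTop (𝓝 (u s))) :
    Tendsto (fun n => volterraOp β c x₀ F (v n) t) atTop (𝓝 (volterraOp β c x₀ F u t)) := by
  rcases ht.eq_or_lt with h | h
  · subst h
    simp only [hV.volterraOp_zero]
    exact tendsto_const_nhds
  obtain ⟨C, hC⟩ := hV.abelBound t h
  refine tendsto_const_nhds.add (Tendsto.const_mul _ (Tendsto.const_mul _ ?_))
  obtain ⟨s₀, hs₀⟩ : (Ioo 0 t).Nonempty := nonempty_Ioo.2 h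
  have hE : 0 ≤ E := (hv 0 s₀ hs₀).1.trans (hv 0 s₀ hs₀).2
  have hC' := hC.const_mul (show 0 ≤ 1 + E by linarith)
  refine tendsto_integral_of_dominated_convergence
    (fun s => t ^ δ * ((t - s) ^ (β - 1 - δ) * ((1 + E) * H s))) (fun n => ?_) ?_ (fun n => ?_) ?_
  · exact (Measurable.aestronglyMeasurable (by fun_prop)).mul (hvm n)
  · exact (hC'.integrableOn t ⟨h, le_rfl⟩).const_mul _
  · refine (ae_restrict_iff' measurableSet_Ioo).2 (Eventually.of_forall fun s hs => ?_)
    have h1 : 0 < t - s := sub_pos.2 hs.2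
    have h2 := rpow_le_rpow_mul_rpow_sub (a := β - 1) hV.δ_pos.le h1
      (show t - s ≤ t by linarith [hs.1])
    rw [Real.norm_eq_abs, abs_mul, abs_of_pos (Real.rpow_pos_of_pos h1 _), ← mul_assoc]
    exact mul_le_mul h2 (hV.abs_le hs.1 (hv n s hs).1 (hv n s hs).2) (abs_nonneg _)
      ((Real.rpow_nonneg h1.le _).trans h2)
  · refine (ae_restrict_iff' measurableSet_Ioo).2 (Eventually.of_forall fun s hs => ?_)
    refine Tendsto.const_mul _ ?_
    have hu : 0 ≤ u s := ge_of_tendsto' (hlim s hs) fun n => (hv n s hs).1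
    refine (hV.continuousOn s hs.1 (u s) hu).tendsto.comp
      (tendsto_nhdsWithin_of_tendsto_nhds_of_eventually_within _ (hlim s hs)
        (Eventually.of_forall fun n => (hv n s hs).1))

/-- An exponential envelope is invariant under the operator: `1 + x₀` uses half of the factor `2`,
and the integral fits in the other half once `2 * c * C * T ^ δ * λ ^ (-δ) ≤ 1`. -/
theorem exists_growth_rate (hV : AbelVolterra β δ c x₀ H F) {T : ℝ} (hT : 0 < T) :
    ∃ lam, 0 < lam ∧ ∀ u : ℝ → ℝ, (∀ s ∈ Icc 0 T, 0 ≤ u s) →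
      (∀ s ∈ Icc 0 T, 1 + u s ≤ 2 * (1 + x₀) * Real.exp (lam * s)) →
      ∀ t ∈ Icc 0 T, 1 + volterraOp β c x₀ F u t ≤ 2 * (1 + x₀) * Real.exp (lam * t) := by
  obtain ⟨C, hC⟩ := hV.abelBound T hT
  have hlim : Tendsto (fun lam : ℝ => 2 * c * C * T ^ δ * lam ^ (-δ)) atTop (𝓝 0) := by
    simpa using (tendsto_rpow_neg_atTop hV.δ_pos).const_mul (2 * c * C * T ^ δ)
  obtain ⟨lam, hlam, hl⟩ :=
    ((hlim.eventually_le_const one_pos).and (eventually_gt_atTop 0)).exists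
  have hx := hV.x₀_nonneg
  have hc := hV.c_nonneg
  have hC0 := hC.const_nonneg
  refine ⟨lam, hl, fun u hu0 hu t ht => ?_⟩
  have hexp : 1 ≤ Real.exp (lam * t) := Real.one_le_exp (mul_nonneg hl.le ht.1)
  rcases ht.1.eq_or_lt with h | h
  · rw [← h, hV.volterraOp_zero]; simp; linarith
  have hb := (hC.const_mul (show 0 ≤ 2 * (1 + x₀) by linarith)).abelIntegral_exp_mul_le
    hV.δ_pos.le hV.δ_le_one hl (f := fun s => F s (u s)) (fun s hs => by
      have hs' : s ∈ Icc 0 T := ⟨hs.1.le, hs.2.le⟩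
      rw [abs_of_nonneg (hV.nonneg s _ hs.1 (hu0 s hs'))]
      calc F s (u s) ≤ H s * (1 + u s) := hV.le s _ hs.1 (hu0 s hs')
        _ ≤ H s * (2 * (1 + x₀) * Real.exp (lam * s)) :=
          mul_le_mul_of_nonneg_left (hu s hs') (hV.weight_nonneg hs.1)
        _ = _ := by ring) ⟨h, ht.2⟩
  have hpow : t ^ (1 - β) * t ^ (β - 1 + δ) = t ^ δ := by
    rw [← Real.rpow_add h]; congr 1; ring
  have htT : t ^ δ ≤ T ^ δ := Real.rpow_le_rpow h.le ht.2 hV.δ_pos.le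
  have hmain : c * (t ^ (1 - β) * abelIntegral β (fun s => F s (u s)) t) ≤
      (1 + x₀) * Real.exp (lam * t) := by
    calc c * (t ^ (1 - β) * abelIntegral β (fun s => F s (u s)) t)
        ≤ c * (t ^ (1 - β) * (Real.exp (lam * t) * lam ^ (-δ) *
          (2 * (1 + x₀) * C * t ^ (β - 1 + δ)))) := by
          have := (le_abs_self _).trans hb
          gcongr
      _ = (1 + x₀) * Real.exp (lam * t) *
          (2 * c * C * (t ^ (1 - β) * t ^ (β - 1 + δ)) * lam ^ (-δ)) := by ring
      _ ≤ (1 + x₀) * Real.exp (lam * t) * (2 * c * C * T ^ δ * lam ^ (-δ)) := by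
          rw [hpow]; gcongr
      _ ≤ (1 + x₀) * Real.exp (lam * t) * 1 := by gcongr
      _ = _ := mul_one _
  have : (1 + x₀) * 1 ≤ (1 + x₀) * Real.exp (lam * t) := by gcongr
  simp only [volterraOp]
  linarith

/-- With a delay, the value at `t` depends only on values before `t - 1 / (n + 1)`. Iteration from
the constant `x₀` therefore becomes stationary on longer and longer intervals, without any Lipschitz
condition. -/
theorem exists_delayed_approximations (hV : AbelVolterra β δ c x₀ H F) :
    ∃ (w : ℕ → ℝ → ℝ) (E : ℝ → ℝ), (∀ n, Continuous (w n)) ∧ (∀ n t, 0 ≤ w n t) ∧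
      (∀ T, 0 < T → ∀ n, ∀ t ∈ Icc 0 T, w n t ≤ E T) ∧
      ∀ (n : ℕ) (t : ℝ), t ≤ n →
        w n t = volterraOp β c x₀ F (w n) (max (t - 1 / ((n : ℝ) + 1)) 0) := by
  choose! Λ hΛ0 hΛ using fun T hT => hV.exists_growth_rate (T := T) hT
  have hx := hV.x₀_nonneg
  let Good : (ℝ → ℝ) → Prop := fun u => Continuous u ∧ (∀ t, 0 ≤ u t) ∧
    ∀ T, 0 < T → ∀ t ∈ Icc 0 T, 1 + u t ≤ 2 * (1 + x₀) * Real.exp (Λ T * t)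
  have hexp : ∀ T, 0 < T → ∀ s t, s ≤ t → Real.exp (Λ T * s) ≤ Real.exp (Λ T * t) :=
    fun T hT s t hst => Real.exp_le_exp.2 (mul_le_mul_of_nonneg_left hst (hΛ0 T hT).le)
  have hgood0 : Good fun _ => x₀ := by
    refine ⟨continuous_const, fun _ => hx, fun T hT t ht => ?_⟩
    have := hexp T hT 0 t ht.1
    rw [mul_zero, Real.exp_zero] at this
    nlinarith
  have hstep : ∀ η : ℝ, 0 ≤ η → ∀ u, Good u →
      Good fun t => volterraOp β c x₀ F u (max (t - η) 0) := by
    intro η hη u hu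
    refine ⟨?_, fun t => hV.volterraOp_nonneg (le_max_right _ _) fun s _ => hu.2.1 s, ?_⟩
    · refine (hV.continuousOn_volterraOp (fun T => hV.aestronglyMeasurable hu.1 hu.2.1 T)
        (fun s _ => hu.2.1 s) fun T hT => ?_).comp_continuous (by fun_prop)
          fun t => mem_Ici.2 (le_max_right _ _)
      exact ⟨2 * (1 + x₀) * Real.exp (Λ T * T), fun s hs => by
        have h1 := hu.2.2 T hT s hs
        have h2 := hexp T hT s T hs.2
        nlinarith⟩
    · intro T hT t ht
      have hτ : max (t - η) 0 ≤ t := max_le (by linarith) ht.1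
      refine (hΛ T hT u (fun s _ => hu.2.1 s) (hu.2.2 T hT) _
        ⟨le_max_right _ _, hτ.trans ht.2⟩).trans ?_
      exact mul_le_mul_of_nonneg_left (hexp T hT _ _ hτ) (by linarith)
  let v : ℕ → ℕ → ℝ → ℝ := fun n j => Nat.rec (fun _ => x₀)
    (fun _ u t => volterraOp β c x₀ F u (max (t - 1 / ((n : ℝ) + 1)) 0)) j
  have hvs : ∀ n j t, v n (j + 1) t =
      volterraOp β c x₀ F (v n j) (max (t - 1 / ((n : ℝ) + 1)) 0) := fun _ _ _ => rfl
  have hgood : ∀ n j, Good (v n j) := by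
    intro n j
    induction j with
    | zero => exact hgood0
    | succ j ih => exact hstep _ (by positivity) _ ih
  -- Each iteration settles one more interval of length equal to the delay.
  have hstab : ∀ (n j : ℕ) (t : ℝ), t ≤ j * (1 / ((n : ℝ) + 1)) → v n (j + 1) t = v n j t := by
    intro n j
    have hη : 0 < 1 / ((n : ℝ) + 1) := by positivity
    induction j with
    | zero =>
      intro t ht
      have h0 : t - 1 / ((n : ℝ) + 1) ≤ 0 := by push_cast at ht; linarith
      rw [hvs, max_eq_right h0, hV.volterraOp_zero]
      rfl
    | succ j ih =>
      intro t ht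
      rw [hvs n (j + 1), hvs n j]
      have : ∀ s ∈ Ioo 0 (max (t - 1 / ((n : ℝ) + 1)) 0), v n (j + 1) s = v n j s := by
        intro s hs
        refine ih s ?_
        rcases lt_max_iff.1 hs.2 with h | h
        · push_cast at ht; linarith
        · exact absurd h (not_lt.2 hs.1.le)
      simp only [volterraOp, abelIntegral]
      congr 3
      exact setIntegral_congr_fun measurableSet_Ioo fun s hs => by simp only [this s hs]
  -- After `n * (n + 1)` iterations with delay `1 / (n + 1)` the iterate is stationary up to time
  -- `n`.
  refine ⟨fun n => v n (n * (n + 1)), fun T => 2 * (1 + x₀) * Real.exp (Λ T * T),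
    fun n => (hgood _ _).1, fun n => (hgood _ _).2.1, fun T hT n t ht => ?_, fun n t ht => ?_⟩
  · have h1 := (hgood n (n * (n + 1))).2.2 T hT t ht
    have h2 := hexp T hT t T ht.2
    nlinarith
  · rw [← hvs, hstab]
    refine ht.trans (le_of_eq ?_)
    push_cast
    field_simp

theorem exists_solution (hV : AbelVolterra β δ c x₀ H F) :
    ∃ u : ℝ → ℝ, ContinuousOn u (Ici 0) ∧ (∀ t, 0 ≤ t → 0 ≤ u t) ∧
      ∀ t, 0 ≤ t → u t = volterraOp β c x₀ F u t := by
  obtain ⟨w, E, hwc, hw0, hwE, hw⟩ := hV.exists_delayed_approximations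
  have hE0 : ∀ T, 0 < T → 0 ≤ E T := fun T hT =>
    (hw0 0 0).trans (hwE T hT 0 0 ⟨le_rfl, hT.le⟩)
  -- Half of the equicontinuity radius is reserved for `|s - t|`, half for the delay. The same bound
  -- gives equicontinuity of the approximations at `t` and shows that they nearly solve the equation
  -- there.
  have hclose : ∀ t, 0 ≤ t → ∀ ε, 0 < ε → ∃ η, 0 < η ∧ ∀ᶠ n in atTop, ∀ s ∈ Icc 0 (t + 1),
      |s - t| < η → |w n s - volterraOp β c x₀ F (w n) t| < ε := by
    intro t ht ε hε
    have hT : 0 < t + 1 := by linarith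
    have h := hV.eventually_abs_sub_lt (hE0 _ hT) hT ⟨ht, by linarith⟩ hε
    rw [eventually_nhdsWithin_iff, Metric.eventually_nhds_iff] at h
    obtain ⟨η, hη, h⟩ := h
    refine ⟨η / 2, by linarith, ?_⟩
    filter_upwards [(tendsto_one_div_add_atTop_nhds_zero_nat (𝕜 := ℝ)).eventually_lt_const
      (show 0 < η / 2 by linarith), tendsto_natCast_atTop_atTop.eventually_ge_atTop (t + 1)]
      with n hn1 hn2 s hs hst
    have hn0 : 0 < 1 / ((n : ℝ) + 1) := by positivity
    rw [hw n s (hs.2.trans hn2)]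
    refine h (y := max (s - 1 / ((n : ℝ) + 1)) 0) ?_
      ⟨le_max_right _ _, max_le (by linarith [hs.2]) hT.le⟩ (w n)
      (hV.aestronglyMeasurable (hwc n) (hw0 n) _)
      fun r hr => ⟨hw0 n r, hwE _ hT n r ⟨hr.1.le, hr.2.le⟩⟩
    rw [abs_lt] at hst
    rw [Real.dist_eq, abs_lt]
    constructor
    · linarith [le_max_left (s - 1 / ((n : ℝ) + 1)) 0]
    · rcases max_cases (s - 1 / ((n : ℝ) + 1)) 0 with h | h <;> linarith [h.1]
  -- Tychonoff over the countable set `ℚ` replaces a diagonal extraction; the absolute value keeps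
  -- all times in `[0, ∞)`.
  obtain ⟨y, -, ψ, hψ, hy⟩ := (isCompact_univ_pi
    (fun q : ℚ => isCompact_Icc (a := (0 : ℝ)) (b := E (|(q : ℝ)| + 1)))).tendsto_subseq
    (x := fun n (q : ℚ) => w n |(q : ℝ)|) (fun n q _ => ⟨hw0 _ _, hwE _ (by positivity) n _
      ⟨abs_nonneg _, by linarith⟩⟩)
  have hq : ∀ q : ℚ, Tendsto (fun k => w (ψ k) |(q : ℝ)|) atTop (𝓝 (y q)) :=
    fun q => (tendsto_pi_nhds.1 hy) q
  -- Comparison with a nearby rational `q`: passing between `t` and `q` twice costs four times `ε /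
  -- 6`, convergence at `q` two more. Pointwise convergence is enough, since the limit in the
  -- integral is taken by domination.
  have hcauchy : ∀ t, 0 ≤ t → CauchySeq fun k => w (ψ k) t := by
    intro t ht
    rw [Metric.cauchySeq_iff']
    intro ε hε
    obtain ⟨η, hη, h⟩ := hclose t ht (ε / 6) (by linarith)
    obtain ⟨q, hq1, hq2⟩ := exists_rat_btwn (show t < min (t + η) (t + 1) by
      rw [lt_min_iff]; constructor <;> linarith)
    rw [lt_min_iff] at hq2
    have hq0 : |(q : ℝ)| = q := abs_of_nonneg (ht.trans hq1.le)
    obtain ⟨N₁, hN₁⟩ := Metric.cauchySeq_iff'.1 (hq q).cauchySeq (ε / 6) (by linarith)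
    obtain ⟨N₂, hN₂⟩ := eventually_atTop.1 (hψ.tendsto_atTop.eventually h)
    have hcl : ∀ k, N₂ ≤ k → |w (ψ k) t - w (ψ k) q| < 2 * (ε / 6) := by
      intro k hk
      have h1 := abs_lt.1 (hN₂ k hk t ⟨ht, by linarith⟩ (by simpa using hη))
      have h2 := abs_lt.1 (hN₂ k hk q ⟨ht.trans hq1.le, hq2.2.le⟩
        (by rw [abs_of_pos (by linarith)]; linarith [hq2.1]))
      rw [abs_lt]
      constructor <;> linarith [h1.1, h1.2, h2.1, h2.2]
    refine ⟨N₁ + N₂, fun k hk => ?_⟩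
    have h1 := abs_lt.1 (hcl k (by omega))
    have h2 := abs_lt.1 (hcl (N₁ + N₂) (by omega))
    have h3 := hN₁ k (by omega)
    have h4 := hN₁ (N₁ + N₂) (by omega)
    rw [hq0, Real.dist_eq, abs_lt] at h3 h4
    rw [Real.dist_eq, abs_lt]
    constructor <;> linarith [h1.1, h1.2, h2.1, h2.2, h3.1, h3.2, h4.1, h4.2]
  choose! u hu using fun t ht => cauchySeq_tendsto_of_complete (hcauchy t ht)
  have hu0 : ∀ t, 0 ≤ t → 0 ≤ u t := fun t ht => ge_of_tendsto' (hu t ht) fun _ => hw0 _ _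
  have huE : ∀ T, 0 < T → ∀ t ∈ Icc 0 T, u t ≤ E T := fun T hT t ht =>
    le_of_tendsto' (hu t ht.1) fun _ => hwE T hT _ t ht
  have hfix : ∀ t, 0 ≤ t → u t = volterraOp β c x₀ F u t := by
    intro t ht
    have h1 : Tendsto (fun k => volterraOp β c x₀ F (w (ψ k)) t) atTop
        (𝓝 (volterraOp β c x₀ F u t)) :=
      hV.tendsto_volterraOp (E := E (t + 1)) ht
        (fun k => hV.aestronglyMeasurable (hwc _) (hw0 _) _)
        (fun k s hs => ⟨hw0 _ _, hwE _ (by linarith) _ _ ⟨hs.1.le, by linarith [hs.2]⟩⟩)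
        fun s hs => hu s hs.1.le
    have h2 : Tendsto (fun k => w (ψ k) t - volterraOp β c x₀ F (w (ψ k)) t) atTop (𝓝 0) := by
      rw [Metric.tendsto_nhds]
      intro ε hε
      obtain ⟨η, hη, h⟩ := hclose t ht ε hε
      filter_upwards [hψ.tendsto_atTop.eventually h] with k hk
      rw [Real.dist_eq, sub_zero]
      exact hk t ⟨ht, by linarith⟩ (by simpa using hη)
    have h3 := h2.add h1
    simp only [sub_add_cancel, zero_add] at h3
    exact tendsto_nhds_unique (hu t ht) h3
  have hum : ∀ T, AEStronglyMeasurable (fun s => F s (u s)) (volume.restrict (Ioo 0 T)) := by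
    intro T
    refine aestronglyMeasurable_of_tendsto_ae atTop
      (fun k => hV.aestronglyMeasurable (hwc (ψ k)) (hw0 (ψ k)) T) ?_
    refine (ae_restrict_iff' measurableSet_Ioo).2 (Eventually.of_forall fun s hs => ?_)
    exact (hV.continuousOn s hs.1 (u s) (hu0 s hs.1.le)).tendsto.comp
      (tendsto_nhdsWithin_of_tendsto_nhds_of_eventually_within _ (hu s hs.1.le)
        (Eventually.of_forall fun n => hw0 _ _))
  exact ⟨u, (hV.continuousOn_volterraOp hum hu0 fun T hT => ⟨E T, huE T hT⟩).congr hfix, hu0, hfix⟩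

end AbelVolterra

/-! ### Behaviour of Abel integrals at infinity. -/

theorem beta_one_sub_self (β : ℝ) :
    ProbabilityTheory.beta (1 - β) β = Real.pi / Real.sin (Real.pi * β) := by
  rw [ProbabilityTheory.beta, sub_add_cancel, Real.Gamma_one, div_one, mul_comm,
    Real.Gamma_mul_Gamma_one_sub]

theorem pi_div_sin_pos {β : ℝ} (hβ : 0 < β) (hβ1 : β < 1) :
    0 < Real.pi / Real.sin (Real.pi * β) := by
  rw [← beta_one_sub_self]
  exact ProbabilityTheory.beta_pos (by linarith) hβ

/-- The exponents add up to scaling degree `0`, so `t` drops out. This is the profile that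
determines the limit of the solution. -/
theorem abelIntegral_rpow_neg {β t : ℝ} (hβ : 0 < β) (hβ1 : β < 1) (ht : 0 < t) :
    abelIntegral β (fun s => s ^ (-β)) t = Real.pi / Real.sin (Real.pi * β) := by
  rw [abelIntegral, setIntegral_sub_rpow_mul_rpow (by linarith) (by linarith) ht,
    ← beta_one_sub_self]
  have h1 : β - 1 + -β + 1 = 0 := by ring
  have h2 : -β + 1 = 1 - β := by ring
  rw [h1, h2, Real.rpow_zero, one_mul, sub_add_cancel]

/-- The part before `S` sees a kernel of size at most `(t - S) ^ (β - 1)`, which fades as `t` grows;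
the part after `S` is compared with `s ^ (-β)`. -/
theorem abs_abelIntegral_le_split {β S E t : ℝ} {r : ℝ → ℝ} (hβ : 0 < β) (hβ1 : β < 1)
    (hS : 0 < S) (hSt : S < t) (hE : 0 ≤ E) (hr : IntegrableOn r (Ioo 0 S))
    (hrt : IntegrableOn (fun s => (t - s) ^ (β - 1) * r s) (Ioo 0 t))
    (hrE : ∀ s ∈ Ico S t, |r s| ≤ E * s ^ (-β)) :
    |abelIntegral β r t| ≤ (t - S) ^ (β - 1) * (∫ s in Ioo 0 S, |r s|) +
      E * (Real.pi / Real.sin (Real.pi * β)) := by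
  have ht : 0 < t := hS.trans hSt
  have hd : Disjoint (Ioo 0 S) (Ico S t) :=
    Set.disjoint_left.2 fun s hs hs' => absurd hs.2 (not_lt.2 hs'.1)
  have hu : Ioo 0 S ∪ Ico S t = Ioo 0 t := Ioo_union_Ico_eq_Ioo hS hSt.le
  have hsub1 : Ioo 0 S ⊆ Ioo 0 t := hu ▸ subset_union_left
  have hsub2 : Ico S t ⊆ Ioo 0 t := hu ▸ subset_union_right
  have hK : IntegrableOn (fun s => (t - s) ^ (β - 1) * s ^ (-β)) (Ioo 0 t) :=
    integrableOn_sub_rpow_mul_rpow (by linarith) (by linarith) ht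
  rw [abelIntegral, ← hu, setIntegral_union hd measurableSet_Ico (hrt.mono_set hsub1)
    (hrt.mono_set hsub2)]
  refine (abs_add_le _ _).trans (add_le_add ?_ ?_)
  · rw [← integral_const_mul, ← Real.norm_eq_abs]
    refine norm_integral_le_of_norm_le (hr.abs.const_mul _)
      ((ae_restrict_iff' measurableSet_Ioo).2 (Eventually.of_forall fun s hs => ?_))
    have h1 : 0 < t - s := by linarith [hs.2]
    rw [norm_mul, Real.norm_of_nonneg (Real.rpow_nonneg h1.le _), Real.norm_eq_abs]
    refine mul_le_mul_of_nonneg_right ?_ (abs_nonneg _)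
    exact Real.rpow_le_rpow_of_nonpos (by linarith) (by linarith [hs.2]) (by linarith)
  · rw [← abelIntegral_rpow_neg hβ hβ1 ht, abelIntegral, ← Real.norm_eq_abs]
    refine (norm_integral_le_of_norm_le ((hK.mono_set hsub2).const_mul E)
      ((ae_restrict_iff' measurableSet_Ico).2 (Eventually.of_forall fun s hs => ?_))).trans ?_
    · have h1 : 0 < t - s := by linarith [hs.2]
      rw [norm_mul, Real.norm_of_nonneg (Real.rpow_nonneg h1.le _), Real.norm_eq_abs]
      calc (t - s) ^ (β - 1) * |r s| ≤ (t - s) ^ (β - 1) * (E * s ^ (-β)) :=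
            mul_le_mul_of_nonneg_left (hrE s hs) (Real.rpow_nonneg h1.le _)
        _ = _ := by ring
    · rw [integral_const_mul]
      refine mul_le_mul_of_nonneg_left ?_ hE
      refine setIntegral_mono_set hK ?_ (LE.le.eventuallyLE hsub2)
      exact (ae_restrict_iff' measurableSet_Ioo).2 (Eventually.of_forall fun s hs =>
        mul_nonneg (Real.rpow_nonneg (sub_nonneg.2 hs.2.le) _) (Real.rpow_nonneg hs.1.le _))

theorem integrableOn_rpow_neg {β T : ℝ} (hβ1 : β < 1) (hT : 0 < T) :
    IntegrableOn (fun s : ℝ => s ^ (-β)) (Ioo 0 T) := by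
  simpa using integrableOn_sub_rpow_mul_rpow (a := 0) (c := -β) (by norm_num) (by linarith) hT

theorem tendsto_abelIntegral {β b : ℝ} {f : ℝ → ℝ} (hβ : 0 < β) (hβ1 : β < 1)
    (hf : ∀ T, 0 < T → IntegrableOn f (Ioo 0 T))
    (hft : ∀ t, 0 < t → IntegrableOn (fun s => (t - s) ^ (β - 1) * f s) (Ioo 0 t))
    (hb : Tendsto (fun t => t ^ β * f t) atTop (𝓝 b)) :
    Tendsto (abelIntegral β f) atTop (𝓝 (b * (Real.pi / Real.sin (Real.pi * β)))) := by
  set A := Real.pi / Real.sin (Real.pi * β)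
  have hA : 0 < A := pi_div_sin_pos hβ hβ1
  set r : ℝ → ℝ := fun s => f s - b * s ^ (-β) with hr
  have hK : ∀ t : ℝ, 0 < t → IntegrableOn (fun s => (t - s) ^ (β - 1) * s ^ (-β)) (Ioo 0 t) :=
    fun t ht => integrableOn_sub_rpow_mul_rpow (by linarith) (by linarith) ht
  have hri : ∀ T, 0 < T → IntegrableOn r (Ioo 0 T) := fun T hT =>
    (hf T hT).sub ((integrableOn_rpow_neg hβ1 hT).const_mul b)
  have hre : ∀ t, (fun s => (t - s) ^ (β - 1) * r s) =
      fun s => (t - s) ^ (β - 1) * f s - b * ((t - s) ^ (β - 1) * s ^ (-β)) := fun t => by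
    funext s; simp only [hr]; ring
  have hrt : ∀ t, 0 < t → IntegrableOn (fun s => (t - s) ^ (β - 1) * r s) (Ioo 0 t) :=
    fun t ht => by rw [hre]; exact (hft t ht).sub ((hK t ht).const_mul b)
  have hdec : ∀ t, 0 < t → abelIntegral β r t = abelIntegral β f t - b * A := fun t ht => by
    have hAt : A = abelIntegral β (fun s => s ^ (-β)) t := (abelIntegral_rpow_neg hβ hβ1 ht).symm
    rw [abelIntegral, hre, integral_sub (hft t ht) ((hK t ht).const_mul b), integral_const_mul, hAt]
    rfl
  rw [Metric.tendsto_nhds]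
  intro ε hε
  have hε' : 0 < ε / (2 * A) := by positivity
  obtain ⟨S, hS0, hS⟩ : ∃ S, 0 < S ∧ ∀ s, S ≤ s → |s ^ β * f s - b| < ε / (2 * A) := by
    obtain ⟨S, hS⟩ := eventually_atTop.1 (Metric.tendsto_nhds.1 hb _ hε')
    exact ⟨max S 1, by positivity, fun s hs => hS s ((le_max_left _ _).trans hs)⟩
  have hlim : Tendsto (fun t : ℝ => (t - S) ^ (β - 1) * (∫ s in Ioo 0 S, |r s|)) atTop (𝓝 0) := by
    have h1 : Tendsto (fun t : ℝ => (t - S) ^ (-(1 - β))) atTop (𝓝 0) :=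
      (tendsto_rpow_neg_atTop (by linarith)).comp (tendsto_atTop_add_const_right _ _ tendsto_id)
    simpa [neg_sub] using h1.mul_const (∫ s in Ioo 0 S, |r s|)
  filter_upwards [hlim.eventually_lt_const (show 0 < ε / 2 by linarith),
    eventually_gt_atTop S] with t ht htS
  have ht0 := hS0.trans htS
  have h := abs_abelIntegral_le_split hβ hβ1 hS0 htS hε'.le (hri S hS0) (hrt t ht0)
    fun s hs => by
      have hs0 := hS0.trans_le hs.1
      have e : r s = (s ^ β * f s - b) * s ^ (-β) := by
        have : s ^ β * s ^ (-β) = 1 := by rw [← Real.rpow_add hs0]; simp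
        simp only [hr]
        linear_combination (-f s) * this
      rw [e, abs_mul, abs_of_pos (Real.rpow_pos_of_pos hs0 _)]
      exact mul_le_mul_of_nonneg_right (hS s hs.1).le (Real.rpow_nonneg hs0.le _)
  have h2 : ε / (2 * A) * A = ε / 2 := by field_simp
  rw [hdec t ht0] at h
  rw [Real.dist_eq]
  change |abelIntegral β f t - b * A| ≤ _ + ε / (2 * A) * A at h
  linarith

/-- For small `η` the feedback contributes at most half of the running maximum `m` of `y` on `[S,
t]`. If `m` is attained beyond `S + 1`, then `m ≤ C₀ + m / 2`; otherwise it is controlled by the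
maximum on `[S, S + 1]`. -/
theorem exists_bound_of_abelIntegral_eq {β c x₀ : ℝ} {f y : ℝ → ℝ} (hβ : 0 < β) (hβ1 : β < 1)
    (hc : 0 ≤ c) (hx₀ : 0 ≤ x₀) (hyc : ContinuousOn y (Ioi 0)) (hy0 : ∀ t, 0 < t → 0 ≤ y t)
    (hf0 : ∀ t, 0 < t → 0 ≤ f t) (hf : ∀ T, 0 < T → IntegrableOn f (Ioo 0 T))
    (hft : ∀ t, 0 < t → IntegrableOn (fun s => (t - s) ^ (β - 1) * f s) (Ioo 0 t))
    (hy : ∀ t, 0 < t → y t = x₀ * t ^ (β - 1) + c * abelIntegral β f t)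
    (hfy : ∀ η, 0 < η → ∃ C S, 0 ≤ C ∧ 0 < S ∧ ∀ s, S ≤ s → f s ≤ (η * y s + C) * s ^ (-β)) :
    ∃ B S, 0 < S ∧ ∀ t, S ≤ t → y t ≤ B := by
  set A := Real.pi / Real.sin (Real.pi * β)
  have hA : 0 < A := pi_div_sin_pos hβ hβ1
  obtain ⟨η, hη, hηA⟩ : ∃ η, 0 < η ∧ c * (η * A) ≤ 1 / 2 := by
    refine ⟨1 / (2 * (c + 1) * A), by positivity, ?_⟩
    have : c * (1 / (2 * (c + 1) * A) * A) = c / (c + 1) / 2 := by field_simp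
    rw [this]
    have : c / (c + 1) ≤ 1 := (div_le_one (by linarith)).2 (by linarith)
    linarith
  obtain ⟨C, S, hC, hS, hfS⟩ := hfy η hη
  set I := ∫ s in Ioo 0 S, |f s|
  have hI : 0 ≤ I := integral_nonneg fun _ => abs_nonneg _
  set C₀ := x₀ + c * (I + C * A) with hC₀
  have hC₀0 : 0 ≤ C₀ := by positivity
  -- The offset `1` keeps both `t` and `t - S` at least `1`, so their negative powers are at most
  -- `1`.
  have hstep : ∀ t m, S + 1 ≤ t → (∀ s ∈ Icc S t, y s ≤ m) → y t ≤ C₀ + m / 2 := by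
    intro t m ht hm
    have ht0 : 0 < t := by linarith
    have hm0 : 0 ≤ m := (hy0 t ht0).trans (hm t ⟨by linarith, le_rfl⟩)
    have h := abs_abelIntegral_le_split hβ hβ1 hS (show S < t by linarith)
      (show 0 ≤ η * m + C by positivity) (hf S hS) (hft t ht0) fun s hs => by
        have hs0 := hS.trans_le hs.1
        rw [abs_of_nonneg (hf0 s hs0)]
        refine (hfS s hs.1).trans (mul_le_mul_of_nonneg_right ?_ (Real.rpow_nonneg hs0.le _))
        have := mul_le_mul_of_nonneg_left (hm s ⟨hs.1, hs.2.le⟩) hη.le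
        linarith
    have h1 : t ^ (β - 1) ≤ 1 := Real.rpow_le_one_of_one_le_of_nonpos (by linarith) (by linarith)
    have h2 : (t - S) ^ (β - 1) ≤ 1 :=
      Real.rpow_le_one_of_one_le_of_nonpos (by linarith) (by linarith)
    rw [hy t ht0]
    calc x₀ * t ^ (β - 1) + c * abelIntegral β f t
        ≤ x₀ * 1 + c * (1 * I + (η * m + C) * A) := by
          have h3 := (le_abs_self _).trans h
          have h4 : (t - S) ^ (β - 1) * I ≤ 1 * I := mul_le_mul_of_nonneg_right h2 hI
          refine add_le_add (mul_le_mul_of_nonneg_left h1 hx₀) (mul_le_mul_of_nonneg_left ?_ hc)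
          exact h3.trans (add_le_add h4 le_rfl)
      _ = C₀ + c * (η * A) * m := by rw [hC₀]; ring
      _ ≤ C₀ + 1 / 2 * m := by gcongr
      _ = _ := by ring
  have hmax : ∀ t, S ≤ t → ∃ s ∈ Icc S t, ∀ r ∈ Icc S t, y r ≤ y s := fun t ht =>
    isCompact_Icc.exists_isMaxOn (nonempty_Icc.2 ht)
      (hyc.mono fun s hs => hS.trans_le hs.1)
  obtain ⟨s₁, -, hs₁⟩ := hmax (S + 1) (by linarith)
  refine ⟨max (y s₁) (2 * C₀), S, hS, fun t ht => ?_⟩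
  obtain ⟨s, hs, hst⟩ := hmax t ht
  refine (hst t ⟨ht, le_rfl⟩).trans ?_
  rcases le_total s (S + 1) with h | h
  · exact (hs₁ s ⟨hs.1, h⟩).trans (le_max_left _ _)
  · have := hstep s (y s) h fun r hr => hst r ⟨hr.1, hr.2.trans hs.2⟩
    exact le_trans (by linarith) (le_max_right _ _)

/-! ### From the integral equation to the fractional derivative. -/

/-- The semigroup property `I^(1 - β) (I^β f) = I^1 f`, without the normalizing constants. -/
theorem integral_abelIntegral_mul {β t : ℝ} {f : ℝ → ℝ} (hβ : 0 < β) (hβ1 : β < 1)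
    (hfm : AEStronglyMeasurable f (volume.restrict (Ioi 0)))
    (hf : ∀ T, 0 < T → IntegrableOn f (Ioo 0 T))
    (hft : ∀ t, 0 < t → IntegrableOn (fun s => (t - s) ^ (β - 1) * f s) (Ioo 0 t)) (ht : 0 < t) :
    ∫ s in Ioo 0 t, abelIntegral β f s * (t - s) ^ (-β) =
      Real.pi / Real.sin (Real.pi * β) * ∫ s in Ioo 0 t, f s := by
  set A := Real.pi / Real.sin (Real.pi * β) with hAdef
  -- After extension by zero to the line, the claim is `(f₁ * g) * k = f₁ * (g * k)`, where `g * k`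
  -- is the constant `A` on `(0, ∞)`.
  set f₁ : ℝ → ℝ := (Ioi 0).indicator f with hf₁
  set g : ℝ → ℝ := (Ioi 0).indicator (fun s => s ^ (β - 1)) with hg
  set k : ℝ → ℝ := (Ioi 0).indicator (fun s => s ^ (-β)) with hk
  have hg0 : ∀ s, 0 ≤ g s := fun s =>
    Set.indicator_nonneg (fun s hs => Real.rpow_nonneg (le_of_lt hs) _) s
  have hk0 : ∀ s, 0 ≤ k s := fun s =>
    Set.indicator_nonneg (fun s hs => Real.rpow_nonneg (le_of_lt hs) _) s
  have prodInd : ∀ (F G : ℝ → ℝ) (y : ℝ),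
      (fun s => (Ioi 0).indicator F s * (Ioi 0).indicator G (y - s)) =
        (Ioo 0 y).indicator fun s => F s * G (y - s) := by
    intro F G y
    funext s
    by_cases h1 : 0 < s
    · by_cases h2 : s < y
      · rw [indicator_of_mem (mem_Ioi.2 h1), indicator_of_mem (mem_Ioi.2 (sub_pos.2 h2)),
          indicator_of_mem (mem_Ioo.2 ⟨h1, h2⟩)]
      · rw [indicator_of_notMem (s := Ioi 0) (a := y - s) (by simpa using h2),
          indicator_of_notMem (s := Ioo 0 y) (fun h => h2 h.2), mul_zero]
    · rw [indicator_of_notMem (s := Ioi 0) (a := s) (by simpa using h1),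
        indicator_of_notMem (s := Ioo 0 y) (fun h => h1 h.1), zero_mul]
  have hfg_eq : ∀ y, (fun s => f₁ s * g (y - s)) =
      (Ioo 0 y).indicator fun s => (y - s) ^ (β - 1) * f s := fun y => by
    rw [hf₁, hg, prodInd]; simp only [mul_comm]
  have hgk_eq : ∀ y, (fun s => g s * k (y - s)) =
      (Ioo 0 y).indicator fun s => (y - s) ^ (-β) * s ^ (β - 1) := fun y => by
    rw [hg, hk, prodInd]; simp only [mul_comm]
  have hfg : ∀ y, ConvolutionExistsAt f₁ g y (ContinuousLinearMap.mul ℝ ℝ) volume := by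
    intro y
    change Integrable (fun s => f₁ s * g (y - s))
    rw [hfg_eq, integrable_indicator_iff measurableSet_Ioo]
    rcases lt_or_ge 0 y with h | h
    · exact hft y h
    · simp [Ioo_eq_empty (not_lt.2 h)]
  have hgk : ∀ y, ConvolutionExistsAt g k y (ContinuousLinearMap.mul ℝ ℝ) volume := by
    intro y
    change Integrable (fun s => g s * k (y - s))
    rw [hgk_eq, integrable_indicator_iff measurableSet_Ioo]
    rcases lt_or_ge 0 y with h | h
    · exact integrableOn_sub_rpow_mul_rpow (by linarith) (by linarith) h
    · simp [Ioo_eq_empty (not_lt.2 h)]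
  have hfg_val : ∀ y, convolution f₁ g (ContinuousLinearMap.mul ℝ ℝ) volume y =
      abelIntegral β f y := by
    intro y
    change ∫ s, f₁ s * g (y - s) = _
    rw [hfg_eq, integral_indicator measurableSet_Ioo]
    rfl
  have hgk_val : convolution g k (ContinuousLinearMap.mul ℝ ℝ) volume =
      (Ioi 0).indicator fun _ => A := by
    funext y
    change ∫ s, g s * k (y - s) = _
    rw [hgk_eq, integral_indicator measurableSet_Ioo]
    rcases lt_or_ge 0 y with h | h
    · rw [setIntegral_sub_rpow_mul_rpow (by linarith) (by linarith) h,
        indicator_of_mem (mem_Ioi.2 h), hAdef, ← beta_one_sub_self, ProbabilityTheory.beta, ProbabilityTheory.beta]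
      have e1 : -β + (β - 1) + 1 = 0 := by ring
      have e2 : -β + 1 = 1 - β := by ring
      rw [e1, e2, Real.rpow_zero, one_mul, sub_add_cancel]
      rw [mul_comm (Real.Gamma β), add_comm β]
    · rw [indicator_of_notMem (by simpa using h), Ioo_eq_empty (not_lt.2 h)]; simp
  have hnorm : ∀ v : ℝ → ℝ, (∀ s, 0 ≤ v s) → (fun s => ‖v s‖) = v := fun v hv => by
    funext s; exact Real.norm_of_nonneg (hv s)
  have hassoc := convolution_assoc (ContinuousLinearMap.mul ℝ ℝ) (ContinuousLinearMap.mul ℝ ℝ)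
    (ContinuousLinearMap.mul ℝ ℝ) (ContinuousLinearMap.mul ℝ ℝ) (f := f₁) (g := g) (k := k)
    (μ := volume) (ν := volume) (x₀ := t) (fun x y z => mul_assoc x y z)
    ((aestronglyMeasurable_indicator_iff measurableSet_Ioi).2 hfm)
    (Measurable.aestronglyMeasurable (Measurable.indicator (by fun_prop) measurableSet_Ioi))
    (Measurable.aestronglyMeasurable (Measurable.indicator (by fun_prop) measurableSet_Ioi))
    (Eventually.of_forall hfg)
    (by rw [hnorm g hg0, hnorm k hk0]; exact Eventually.of_forall hgk)
    (by
      rw [hnorm g hg0, hnorm k hk0, hgk_val]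
      change Integrable (fun s => ‖f₁ s‖ * (Ioi 0).indicator (fun _ => A) (t - s))
      have : (fun s => ‖f₁ s‖ * (Ioi 0).indicator (fun _ => A) (t - s)) =
          (Ioo 0 t).indicator fun s => ‖f s‖ * A := by
        rw [← prodInd (fun s => ‖f s‖) (fun _ => A)]
        funext s
        rw [hf₁, norm_indicator_eq_indicator_norm]
      rw [this, integrable_indicator_iff measurableSet_Ioo]
      exact (hf t ht).norm.mul_const A)
  rw [hgk_val] at hassoc
  have hL : convolution (convolution f₁ g (ContinuousLinearMap.mul ℝ ℝ) volume) k
      (ContinuousLinearMap.mul ℝ ℝ) volume t =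
      ∫ s in Ioo 0 t, abelIntegral β f s * (t - s) ^ (-β) := by
    change ∫ s, convolution f₁ g (ContinuousLinearMap.mul ℝ ℝ) volume s * k (t - s) = _
    rw [← integral_indicator measurableSet_Ioo,
      ← prodInd (fun s => abelIntegral β f s) (fun s => s ^ (-β))]
    refine integral_congr_ae (Eventually.of_forall fun s => ?_)
    simp only [hfg_val]
    by_cases h : 0 < s
    · rw [indicator_of_mem (mem_Ioi.2 h)]
    · rw [indicator_of_notMem (s := Ioi 0) (a := s) (by simpa using h), abelIntegral,
        Ioo_eq_empty h]
      simp
  have hR : convolution f₁ ((Ioi 0).indicator fun _ => A) (ContinuousLinearMap.mul ℝ ℝ) volume t =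
      A * ∫ s in Ioo 0 t, f s := by
    change ∫ s, f₁ s * (Ioi 0).indicator (fun _ => A) (t - s) = _
    rw [hf₁, prodInd f (fun _ => A), integral_indicator measurableSet_Ioo, integral_mul_const,
      mul_comm]
  rw [← hL, ← hR, ← hassoc]

/-- The singular term `x₀ * s ^ (β - 1)` contributes only the constant `x₀ * Γ(β)`, again by scaling
degree `0`; the rest is the semigroup law. -/
theorem rlIntegral_one_sub_eq {β x₀ t : ℝ} {f x : ℝ → ℝ} (hβ : 0 < β) (hβ1 : β < 1)
    (hfm : AEStronglyMeasurable f (volume.restrict (Ioi 0)))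
    (hf : ∀ T, 0 < T → IntegrableOn f (Ioo 0 T))
    (hft : ∀ t, 0 < t → IntegrableOn (fun s => (t - s) ^ (β - 1) * f s) (Ioo 0 t))
    (hx : ∀ s, 0 < s → x s = x₀ * s ^ (β - 1) + 1 / Real.Gamma β * abelIntegral β f s)
    (ht : 0 < t) (hxt : IntegrableOn (fun s => (t - s) ^ (-β) * x s) (Ioo 0 t)) :
    rlIntegral (1 - β) x t = x₀ * Real.Gamma β + ∫ s in (0 : ℝ)..t, f s := by
  have hG := Real.Gamma_pos_of_pos hβ
  have hG1 := Real.Gamma_pos_of_pos (sub_pos.2 hβ1)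
  have hK : IntegrableOn (fun s => (t - s) ^ (-β) * s ^ (β - 1)) (Ioo 0 t) :=
    integrableOn_sub_rpow_mul_rpow (by linarith) (by linarith) ht
  have hA : Real.pi / Real.sin (Real.pi * β) = Real.Gamma β * Real.Gamma (1 - β) :=
    (Real.Gamma_mul_Gamma_one_sub β).symm
  have hval : ∫ s in Ioo 0 t, (t - s) ^ (-β) * s ^ (β - 1) =
      Real.Gamma β * Real.Gamma (1 - β) := by
    rw [setIntegral_sub_rpow_mul_rpow (by linarith) (by linarith) ht, ProbabilityTheory.beta]
    have e1 : -β + (β - 1) + 1 = 0 := by ring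
    have e2 : β - 1 + 1 + (-β + 1) = 1 := by ring
    have e3 : -β + 1 = 1 - β := by ring
    rw [e1, e2, e3, sub_add_cancel]
    simp
  have hxe : ∀ s ∈ Ioo 0 t, 1 / Real.Gamma β * (abelIntegral β f s * (t - s) ^ (-β)) =
      (t - s) ^ (-β) * x s - x₀ * ((t - s) ^ (-β) * s ^ (β - 1)) := fun s hs => by
    rw [hx s hs.1]; ring
  have h1 := setIntegral_congr_fun (μ := volume) measurableSet_Ioo hxe
  rw [integral_const_mul, integral_abelIntegral_mul hβ hβ1 hfm hf hft ht,
    integral_sub hxt (hK.const_mul x₀), integral_const_mul, hval, hA] at h1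
  have h2 : ∫ s in (0 : ℝ)..t, x s / (t - s) ^ (1 - (1 - β)) =
      ∫ s in Ioo 0 t, (t - s) ^ (-β) * x s := by
    rw [intervalIntegral.integral_of_le ht.le, integral_Ioc_eq_integral_Ioo]
    refine setIntegral_congr_fun measurableSet_Ioo fun s hs => ?_
    simp only [sub_sub_cancel]
    rw [Real.rpow_neg (sub_nonneg.2 hs.2.le), div_eq_mul_inv, mul_comm]
  rw [rlIntegral, h2, intervalIntegral.integral_of_le ht.le, integral_Ioc_eq_integral_Ioo]
  field_simp at h1 ⊢
  linarith

/-! ### The fractional problem as an Abel-Volterra equation. -/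

theorem rpow_le_one_add {u μ : ℝ} (hu : 0 ≤ u) (hμ0 : 0 ≤ μ) (hμ1 : μ ≤ 1) : u ^ μ ≤ 1 + u := by
  rcases le_total u 1 with h | h
  · exact (Real.rpow_le_one hu h hμ0).trans (by linarith)
  · calc u ^ μ ≤ u ^ (1 : ℝ) := Real.rpow_le_rpow_of_exponent_le h hμ1
      _ = u := Real.rpow_one u
      _ ≤ 1 + u := by linarith

theorem ContinuousOn.of_rpow_mul {a : ℝ} {f : ℝ → ℝ}
    (hf : ContinuousOn (fun t : ℝ => t ^ a * f t) (Ioi 0)) : ContinuousOn f (Ioi 0) := by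
  have h : ContinuousOn (fun t : ℝ => t ^ (-a)) (Ioi 0) := fun t ht =>
    (Real.continuousAt_rpow_const _ _ (Or.inl (ne_of_gt ht))).continuousWithinAt
  refine (h.mul hf).congr fun t ht => ?_
  change f t = t ^ (-a) * (t ^ a * f t)
  rw [← mul_assoc, ← Real.rpow_add ht]
  simp

theorem abelVolterra_of_sublinear {β μ p x₀ M : ℝ} {l k φ : ℝ → ℝ}
    (hβ : 0 < β) (hβ1 : β < 1) (hμ0 : 0 ≤ μ) (hμ1 : μ ≤ 1) (hp : 1 / β < p) (hx₀ : 0 ≤ x₀)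
    (hl0 : ∀ t : ℝ, 0 < t → 0 ≤ l t)
    (hlc : ContinuousOn (fun t : ℝ => t ^ ((1 - μ) * (1 - β)) * l t) (Ioi 0))
    (hlp : MemLpLoc p (fun t : ℝ => t ^ ((1 - μ) * (1 - β)) * l t))
    (hk0 : ∀ t : ℝ, 0 < t → 0 ≤ k t)
    (hkc : ContinuousOn (fun t : ℝ => t ^ (1 - β) * k t) (Ioi 0))
    (hkp : MemLpLoc p (fun t : ℝ => t ^ (1 - β) * k t))
    (hφc : ContinuousOn φ (Ici 0)) (hφ0 : ∀ u : ℝ, 0 ≤ u → 0 ≤ φ u)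
    (hM : 0 ≤ M) (hφM : ∀ u : ℝ, 0 ≤ u → |φ u| ≤ M * u ^ μ) :
    AbelVolterra β ((β - 1 / p) / 2) (1 / Real.Gamma β) x₀
      (fun s => s ^ (β - 1) *
        (M * (s ^ ((1 - μ) * (1 - β)) * l s) + s ^ (1 - β) * k s))
      (fun s u => l s * φ (s ^ (β - 1) * u) + k s) where
  β_pos := hβ
  β_lt_one := hβ1
  δ_pos := by
    have hp0 : 0 < p := lt_trans (by positivity) hp
    have : 1 / p < β := by
      rw [div_lt_iff₀ hp0]; rw [div_lt_iff₀ hβ] at hp; linarith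
    linarith
  δ_le_one := by
    have hp0 : 0 < p := lt_trans (by positivity) hp
    have : 0 < 1 / p := by positivity
    linarith
  c_nonneg := (one_div_pos.2 (Real.Gamma_pos_of_pos hβ)).le
  x₀_nonneg := hx₀
  abelBound T hT := by
    refine exists_abelBound_of_memLp hβ hβ1 hp (fun s hs => ?_) ?_
    · have := hl0 s hs.1
      have := hk0 s hs.1
      have := hs.1
      positivity
    · exact (((hlp T hT).const_mul M).add (hkp T hT)).mono_measure
        (Measure.restrict_mono Ioo_subset_Icc_self le_rfl)
  continuousOn s hs := by
    refine (continuousOn_const.mul (hφc.comp (by fun_prop) fun u hu => ?_)).add continuousOn_const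
    exact mul_nonneg (Real.rpow_nonneg hs.le _) hu
  nonneg s u hs hu := add_nonneg (mul_nonneg (hl0 s hs)
    (hφ0 _ (mul_nonneg (Real.rpow_nonneg hs.le _) hu))) (hk0 s hs)
  le s u hs hu := by
    have hsp := Real.rpow_nonneg hs.le (β - 1)
    have h1 : φ (s ^ (β - 1) * u) ≤ M * (s ^ ((β - 1) * μ) * (1 + u)) := by
      refine (le_abs_self _).trans ((hφM _ (mul_nonneg hsp hu)).trans ?_)
      rw [Real.mul_rpow hsp hu, ← Real.rpow_mul hs.le]
      exact mul_le_mul_of_nonneg_left (mul_le_mul_of_nonneg_left (rpow_le_one_add hu hμ0 hμ1)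
        (Real.rpow_nonneg hs.le _)) hM
    -- The weight imposed on `l` is exactly what absorbs the factor `s ^ ((β - 1) * μ)` coming from
    -- `(s ^ (β - 1) * u) ^ μ`.
    have h2 : s ^ (β - 1) * s ^ ((1 - μ) * (1 - β)) = s ^ ((β - 1) * μ) := by
      rw [← Real.rpow_add hs]; congr 1; ring
    have h3 : s ^ (β - 1) * s ^ (1 - β) = 1 := by
      rw [← Real.rpow_add hs]; simp
    have h4 : 0 ≤ k s * u := mul_nonneg (hk0 s hs) hu
    calc l s * φ (s ^ (β - 1) * u) + k s
        ≤ l s * (M * (s ^ ((β - 1) * μ) * (1 + u))) + (k s + k s * u) :=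
          add_le_add (mul_le_mul_of_nonneg_left h1 (hl0 s hs)) (by linarith)
      _ = _ := by linear_combination (-(M * l s * (1 + u))) * h2 - k s * (1 + u) * h3
  continuousOn_comp u hu hu0 := by
    have hr : ContinuousOn (fun s : ℝ => s ^ (β - 1)) (Ioi 0) := fun t ht =>
      (Real.continuousAt_rpow_const _ _ (Or.inl (ne_of_gt ht))).continuousWithinAt
    exact (hlc.of_rpow_mul.mul (hφc.comp (hr.mul hu.continuousOn) fun s hs =>
      mul_nonneg (Real.rpow_nonneg (le_of_lt hs) _) (hu0 s))).add hkc.of_rpow_mul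

/-- A function given by the Abel integral equation solves the Riemann-Liouville initial value
problem. -/
theorem isRLSolution_of_abelIntegral_eq {β x₀ : ℝ} {l k φ x u : ℝ → ℝ} (hβ : 0 < β) (hβ1 : β < 1)
    (hu : ContinuousOn u (Ici 0)) (hu0 : u 0 = x₀) (hxu : ∀ t, 0 < t → x t = t ^ (β - 1) * u t)
    (hfc : ContinuousOn (fun t => l t * φ (x t) + k t) (Ioi 0))
    (hf : ∀ T, 0 < T → IntegrableOn (fun t => l t * φ (x t) + k t) (Ioo 0 T))
    (hft : ∀ t, 0 < t →
      IntegrableOn (fun s => (t - s) ^ (β - 1) * (l s * φ (x s) + k s)) (Ioo 0 t))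
    (hx : ∀ t, 0 < t → x t = x₀ * t ^ (β - 1) +
      1 / Real.Gamma β * abelIntegral β (fun t => l t * φ (x t) + k t) t) :
    IsRLSolution β x₀ l k φ x := by
  set f : ℝ → ℝ := fun t => l t * φ (x t) + k t with hfdef
  have hr : ContinuousOn (fun s : ℝ => s ^ (β - 1)) (Ioi 0) := fun t ht =>
    (Real.continuousAt_rpow_const _ _ (Or.inl (ne_of_gt ht))).continuousWithinAt
  have hxc : ContinuousOn x (Ioi 0) :=
    (hr.mul (hu.mono Ioi_subset_Ici_self)).congr fun t ht => hxu t ht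
  have hbound : ∀ T, 0 < T → ∃ E, ∀ s ∈ Ioo 0 T, ‖x s‖ ≤ E * s ^ (β - 1) := by
    intro T hT
    obtain ⟨E, hE⟩ := isCompact_Icc.exists_bound_of_continuousOn
      (hu.mono (Icc_subset_Ici_self : Icc 0 T ⊆ Ici 0))
    refine ⟨E, fun s hs => ?_⟩
    have hsp := Real.rpow_nonneg hs.1.le (β - 1)
    rw [hxu s hs.1, norm_mul, Real.norm_of_nonneg hsp, mul_comm]
    exact mul_le_mul_of_nonneg_right (hE s ⟨hs.1.le, hs.2.le⟩) hsp
  have hxm : ∀ T, AEStronglyMeasurable x (volume.restrict (Ioo 0 T)) := fun T =>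
    (hxc.mono Ioo_subset_Ioi_self).aestronglyMeasurable measurableSet_Ioo
  have hweight : ∀ a T : ℝ, -1 < a → 0 < T → IntegrableOn (fun s => (T - s) ^ a * x s) (Ioo 0 T) := by
    intro a T ha hT
    obtain ⟨E, hE⟩ := hbound T hT
    refine Integrable.mono' ((integrableOn_sub_rpow_mul_rpow ha (show -1 < β - 1 by linarith)
      hT).const_mul E) ((Measurable.aestronglyMeasurable (by fun_prop)).mul (hxm T))
      ((ae_restrict_iff' measurableSet_Ioo).2 (Eventually.of_forall fun s hs => ?_))
    have hsp := Real.rpow_nonneg (sub_nonneg.2 hs.2.le) a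
    rw [norm_mul, Real.norm_of_nonneg hsp]
    calc (T - s) ^ a * ‖x s‖ ≤ (T - s) ^ a * (E * s ^ (β - 1)) :=
          mul_le_mul_of_nonneg_left (hE s hs) hsp
      _ = _ := by ring
  have hrl : ∀ t, 0 < t →
      rlIntegral (1 - β) x t = x₀ * Real.Gamma β + ∫ s in (0 : ℝ)..t, f s := fun t ht =>
    rlIntegral_one_sub_eq hβ hβ1 (hfc.aestronglyMeasurable measurableSet_Ioi) hf hft hx ht
      (hweight _ t (by linarith) ht)
  have hfi : ∀ T, 0 < T → IntervalIntegrable f volume 0 T := fun T hT => by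
    rw [intervalIntegrable_iff_integrableOn_Ioo_of_le hT.le]
    exact hf T hT
  refine ⟨fun T hT => ?_, fun T hT => ?_, fun t ht => ?_, ?_⟩
  · rw [integrableOn_Ioc_iff_integrableOn_Ioo]
    simpa using hweight 0 T (by norm_num) hT
  · refine ⟨fun t => x₀ * Real.Gamma β + ∫ s in (0 : ℝ)..t, f s, ?_, fun t ht => (hrl t ht.1).symm⟩
    have hconst : AbsolutelyContinuousOnInterval (fun _ : ℝ => x₀ * Real.Gamma β) 0 T :=
      (LipschitzWith.const (x₀ * Real.Gamma β)).lipschitzOnWith.absolutelyContinuousOnInterval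
    exact hconst.add ((hfi T hT).absolutelyContinuousOnInterval_intervalIntegral left_mem_uIcc)
  -- Continuity of `f` on `(0, ∞)` gives the derivative at every `t > 0`, not merely almost
  -- everywhere.
  · have hd : HasDerivAt (fun t => x₀ * Real.Gamma β + ∫ s in (0 : ℝ)..t, f s) (f t) t :=
      (intervalIntegral.integral_hasDerivAt_right (hfi t ht)
        (hfc.stronglyMeasurableAtFilter isOpen_Ioi t ht)
        (hfc.continuousAt (Ioi_mem_nhds ht))).const_add _
    refine hd.congr_of_eventuallyEq ?_
    filter_upwards [Ioi_mem_nhds ht] with s hs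
    exact hrl s hs
  · have h1 : Tendsto u (𝓝[>] 0) (𝓝 x₀) := by
      rw [← hu0]
      exact (hu 0 self_mem_Ici).tendsto.mono_left (nhdsWithin_mono _ Ioi_subset_Ici_self)
    refine h1.congr' ?_
    filter_upwards [self_mem_nhdsWithin] with t ht
    rw [hxu t ht, ← mul_assoc, ← Real.rpow_add ht]
    simp

/-! ### The solution and its limit. -/

theorem theorem3p6
    (β γ μ p x₀ K M b : ℝ) (l k φ : ℝ → ℝ)
    (hβ : 0 < β) (hβγ : β < γ) (hγ : γ < 1)
    (hμ0 : 0 ≤ μ) (hμ1 : μ ≤ 1)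
    (hp : 1 / β < p) (hx₀ : 0 < x₀)
    (hl0 : ∀ t : ℝ, 0 < t → 0 ≤ l t)
    (hlc : ContinuousOn (fun t : ℝ => t ^ ((1 - μ) * (1 - β)) * l t) (Ioi 0))
    (hlp : MemLpLoc p (fun t : ℝ => t ^ ((1 - μ) * (1 - β)) * l t))
    (hK : 0 ≤ K) (hlK : ∀ t : ℝ, 1 ≤ t → t ^ γ * l t ≤ K)
    (hk0 : ∀ t : ℝ, 0 < t → 0 ≤ k t)
    (hkc : ContinuousOn (fun t : ℝ => t ^ (1 - β) * k t) (Ioi 0))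
    (hkp : MemLpLoc p (fun t : ℝ => t ^ (1 - β) * k t))
    (hb : 0 ≤ b) (hkb : Tendsto (fun t : ℝ => t ^ β * k t) atTop (𝓝 b))
    (hφc : ContinuousOn φ (Ici 0)) (hφ0 : ∀ u : ℝ, 0 ≤ u → 0 ≤ φ u)
    (hM : 0 ≤ M) (hφM : ∀ u : ℝ, 0 ≤ u → |φ u| ≤ M * u ^ μ) :
    ∃ x : ℝ → ℝ, x ∈ CPlusWeighted (1 - β) ∧ IsRLSolution β x₀ l k φ x ∧
      Tendsto x atTop (𝓝 (b * Real.pi / (Real.Gamma β * Real.sin (β * Real.pi)))) := by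
  have hβ1 : β < 1 := hβγ.trans hγ
  have hV := abelVolterra_of_sublinear hβ hβ1 hμ0 hμ1 hp hx₀.le hl0 hlc hlp hk0 hkc hkp
    hφc hφ0 hM hφM
  obtain ⟨u, huc, hu0, hu⟩ := hV.exists_solution
  set x : ℝ → ℝ := fun t => t ^ (β - 1) * u t with hxdef
  set f : ℝ → ℝ := fun t => l t * φ (x t) + k t with hfdef
  have hr : ContinuousOn (fun s : ℝ => s ^ (β - 1)) (Ioi 0) := fun t ht =>
    (Real.continuousAt_rpow_const _ _ (Or.inl (ne_of_gt ht))).continuousWithinAt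
  have hxc : ContinuousOn x (Ioi 0) := hr.mul (huc.mono Ioi_subset_Ici_self)
  have hx0 : ∀ t, 0 < t → 0 ≤ x t := fun t ht =>
    mul_nonneg (Real.rpow_nonneg ht.le _) (hu0 t ht.le)
  have hfc : ContinuousOn f (Ioi 0) :=
    (hlc.of_rpow_mul.mul (hφc.comp hxc fun s hs => hx0 s hs)).add hkc.of_rpow_mul
  have hf0 : ∀ t, 0 < t → 0 ≤ f t := fun t ht =>
    add_nonneg (mul_nonneg (hl0 t ht) (hφ0 _ (hx0 t ht))) (hk0 t ht)
  have hfm : ∀ T, AEStronglyMeasurable f (volume.restrict (Ioo 0 T)) := fun T =>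
    (hfc.mono Ioo_subset_Ioi_self).aestronglyMeasurable measurableSet_Ioo
  have hfint : ∀ T, 0 < T → IntegrableOn f (Ioo 0 T) ∧
      IntegrableOn (fun s => (T - s) ^ (β - 1) * f s) (Ioo 0 T) := by
    intro T hT
    obtain ⟨C, hC⟩ := hV.abelBound T hT
    obtain ⟨E, hE⟩ := isCompact_Icc.exists_bound_of_continuousOn
      (huc.mono (Icc_subset_Ici_self : Icc 0 T ⊆ Ici 0))
    have hE0 : 0 ≤ E := (norm_nonneg _).trans (hE 0 ⟨le_rfl, hT.le⟩)
    have hC' := hC.const_mul (show 0 ≤ 1 + E by linarith)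
    have hle : ∀ s ∈ Ioo 0 T, |f s| ≤ _ := fun s hs => hV.abs_le hs.1 (hu0 s hs.1.le)
      ((le_abs_self _).trans (hE s ⟨hs.1.le, hs.2.le⟩))
    exact ⟨hC'.integrableOn_of_le hβ1 hV.δ_pos.le (hfm T) hle hT,
      hC'.kernel_mul_integrableOn hV.δ_pos.le (hfm T) hle ⟨hT, le_rfl⟩⟩
  have hinv : ∀ t : ℝ, 0 < t → t ^ (β - 1) * t ^ (1 - β) = 1 := fun t ht => by
    rw [← Real.rpow_add ht]; simp
  have hx : ∀ t, 0 < t → x t = x₀ * t ^ (β - 1) + 1 / Real.Gamma β * abelIntegral β f t := by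
    intro t ht
    have h1 : u t = x₀ + 1 / Real.Gamma β * (t ^ (1 - β) * abelIntegral β f t) := hu t ht.le
    calc x t = t ^ (β - 1) * (x₀ + 1 / Real.Gamma β * (t ^ (1 - β) * abelIntegral β f t)) := by
          rw [← h1]
      _ = x₀ * t ^ (β - 1) +
          (t ^ (β - 1) * t ^ (1 - β)) * (1 / Real.Gamma β * abelIntegral β f t) := by ring
      _ = _ := by rw [hinv t ht, one_mul]
  have hu00 : u 0 = x₀ := (hu 0 le_rfl).trans (hV.volterraOp_zero u)
  refine ⟨x, ⟨hxc, hx0, u, huc, hu0, fun t ht => ?_⟩,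
    isRLSolution_of_abelIntegral_eq hβ hβ1 huc hu00 (fun _ _ => rfl) hfc
      (fun T hT => (hfint T hT).1) (fun T hT => (hfint T hT).2) hx, ?_⟩
  · rw [hxdef, ← mul_assoc, mul_comm (t ^ (1 - β)), hinv t ht, one_mul]
  -- The surplus `γ - β > 0` is split off as a decaying factor, leaving the critical weight `s ^
  -- (-β)`.
  have hlφ : ∀ s, 1 ≤ s → l s * φ (x s) ≤ K * M * s ^ (-(γ - β)) * (1 + x s) * s ^ (-β) := by
    intro s hs
    have hs0 : 0 < s := by linarith
    have hxs := hx0 s hs0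
    have h1 : φ (x s) ≤ M * (1 + x s) := (le_abs_self _).trans ((hφM _ hxs).trans
      (mul_le_mul_of_nonneg_left (rpow_le_one_add hxs hμ0 hμ1) hM))
    have h2 : l s ≤ K * s ^ (-γ) := by
      rw [Real.rpow_neg hs0.le, ← div_eq_mul_inv, le_div_iff₀ (Real.rpow_pos_of_pos hs0 _),
        mul_comm]
      exact hlK s hs
    have h3 : s ^ (-γ) = s ^ (-(γ - β)) * s ^ (-β) := by
      rw [← Real.rpow_add hs0]; congr 1; ring
    calc l s * φ (x s) ≤ (K * s ^ (-γ)) * (M * (1 + x s)) :=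
          mul_le_mul h2 h1 (hφ0 _ hxs) (mul_nonneg hK (Real.rpow_nonneg hs0.le _))
      _ = _ := by rw [h3]; ring
  have hdecay : Tendsto (fun s : ℝ => K * M * s ^ (-(γ - β))) atTop (𝓝 0) := by
    simpa using (tendsto_rpow_neg_atTop (sub_pos.2 hβγ)).const_mul (K * M)
  have hss : ∀ s : ℝ, 0 < s → s ^ β * s ^ (-β) = 1 := fun s hs => by
    rw [← Real.rpow_add hs]; simp
  -- Boundedness must come first: only then does the decay of the coefficient force the feedback
  -- term to be negligible against `t ^ (-β)`.
  obtain ⟨B, S, hS, hB⟩ : ∃ B S, 0 < S ∧ ∀ t, S ≤ t → x t ≤ B := by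
    refine exists_bound_of_abelIntegral_eq hβ hβ1 hV.c_nonneg hx₀.le hxc hx0 hf0
      (fun T hT => (hfint T hT).1) (fun T hT => (hfint T hT).2) hx fun η hη => ?_
    obtain ⟨S, hS⟩ := eventually_atTop.1 ((hdecay.eventually_le_const hη).and
      ((hkb.eventually_le_const (show b < b + 1 by linarith)).and (eventually_ge_atTop 1)))
    refine ⟨η + (b + 1), max S 1, by positivity, by positivity, fun s hs => ?_⟩
    obtain ⟨h1, h2, h3⟩ := hS s ((le_max_left _ _).trans hs)
    have hs0 : 0 < s := by linarith
    have hxs := hx0 s hs0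
    have hsβ := Real.rpow_nonneg hs0.le (-β)
    have h4 : k s = s ^ β * k s * s ^ (-β) := by linear_combination (-k s) * hss s hs0
    calc f s ≤ η * (1 + x s) * s ^ (-β) + (b + 1) * s ^ (-β) := by
          refine add_le_add ((hlφ s h3).trans ?_) ?_
          · gcongr
          · rw [h4]; gcongr
      _ = _ := by ring
  have hlim0 : Tendsto (fun t => t ^ β * (l t * φ (x t))) atTop (𝓝 0) := by
    have hd := hdecay.mul_const (1 + B)
    rw [zero_mul] at hd
    refine squeeze_zero' ?_ ?_ hd
    · filter_upwards [eventually_gt_atTop 0] with t ht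
      exact mul_nonneg (Real.rpow_nonneg ht.le _) (mul_nonneg (hl0 t ht) (hφ0 _ (hx0 t ht)))
    · filter_upwards [eventually_ge_atTop S, eventually_ge_atTop 1] with t htS ht1
      have ht : 0 < t := by linarith
      have htβ := Real.rpow_nonneg ht.le β
      calc t ^ β * (l t * φ (x t))
          ≤ t ^ β * (K * M * t ^ (-(γ - β)) * (1 + x t) * t ^ (-β)) :=
            mul_le_mul_of_nonneg_left (hlφ t ht1) htβ
        _ = K * M * t ^ (-(γ - β)) * (1 + x t) * (t ^ β * t ^ (-β)) := by ring
        _ ≤ K * M * t ^ (-(γ - β)) * (1 + B) := by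
            rw [hss t ht, mul_one]
            have := hB t htS
            gcongr
  have hflim : Tendsto (fun t => t ^ β * f t) atTop (𝓝 b) := by
    have := hlim0.add hkb
    rw [zero_add] at this
    exact this.congr fun t => by simp only [hfdef]; ring
  have habel := tendsto_abelIntegral hβ hβ1 (fun T hT => (hfint T hT).1)
    (fun T hT => (hfint T hT).2) hflim
  have hpow : Tendsto (fun t : ℝ => x₀ * t ^ (β - 1)) atTop (𝓝 0) := by
    simpa [neg_sub] using
      (tendsto_rpow_neg_atTop (show 0 < 1 - β by linarith)).const_mul x₀
  have hfinal := hpow.add (habel.const_mul (1 / Real.Gamma β))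
  have hval : 0 + 1 / Real.Gamma β * (b * (Real.pi / Real.sin (Real.pi * β))) =
      b * Real.pi / (Real.Gamma β * Real.sin (β * Real.pi)) := by
    rw [mul_comm Real.pi β, zero_add, one_div, ← mul_div_assoc, div_eq_mul_inv, div_eq_mul_inv,
      mul_inv]
    ring
  rw [hval] at hfinal
  refine hfinal.congr' ?_
  filter_upwards [eventually_gt_atTop 0] with t ht
  exact (hx t ht).symm
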